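/- **Setup.** The experimental data are i.i.d. copies $(D_i,X_i)$, $i=1,\dots,n$, of $(D,X)\in\mathbb R\times\mathcal X$ (expectation $E_{\rm rct}$). The observational data are i.i.d. copies $(X_i,Z_i,Y_i)$, $i=n+1,\dots,n+N$, of $(X,Z,Y)\in\mathcal X\times\{0,1\}\times\mathbb R$ (expectation $E_{\rm obs}$, $Y$ integrable), independent of the experimental data. The covariate $X$ has density $f_{\rm rct}$ in the experiment and $f_{\rm obs}$ in the observational population, with respect to a common measure $\lambda$. Let $\Delta(x)=E_{\rm obs}[Y\mid X=x,Z=1]-E_{\rm obs}[Y\mid X=x,Z=0]$, let $\psi:\mathbb R\to\mathbb R^p$ be a known measurable function, let $\mathcal F=\{x\mapsto\beta^\top\psi(\Delta(x)):\beta\in\mathbb R^p\}$, and put $$\bar\mu\in\operatorname*{argmin}_{f\in\mathcal F}E_{\rm rct}[(D-f(X))^2],\qquad \bar\tau=E_{\rm obs}[\bar\mu(X)].$$ **Estimator.** Fix $K\ge1$. Partition $\{n+1,\dots,n+N\}$ at random (independently of the data) and as evenly as possible into folds $\mathcal I_1,\dots,\mathcal I_K$. Let $\hat\Delta^{(-k)}$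 be the output of a (possibly randomized) learner applied to the observational units outside $\mathcal I_k$, and let $\hat\Delta=K^{-1}\sum_k\hat\Delta^{(-k)}$. Let $\hat\beta$ be an ordinary least squares coefficient of $D_i$ on $\psi(\hat\Delta(X_i))$, $i=1,\dots,n$; write $\hat\mu=\hat\beta^\top\psi(\hat\Delta(\cdot))$, $\hat\mu^{(-k)}=\hat\beta^\top\psi(\hat\Delta^{(-k)}(\cdot))$, and $$\hat{\bar\tau}=\frac1N\sum_{k=1}^K\sum_{i\in\mathcal I_k}\hat\mu^{(-k)}(X_i),\qquad \hat V=\hat a^\top\Big(\frac1{n^2}\sum_{i=1}^n\hat r_i\hat r_i^\top\Big)\hat a+\frac1{N^2}\sum_{k=1}^K\sum_{i\in\mathcal I_k}\big(\hat\mu^{(-k)}(X_i)-\hat{\bar\tau}\big)^2,$$ where $\hat a=\big(\frac1n\sum_{i=1}^n\psi(\hat\Delta(X_i))\psi(\hat\Delta(X_i))^\top\big)^{-1}\frac1N\sum_k\sum_{i\in\mathcal I_k}\psi(\hat\Delta^{(-k)}(X_i))$ and $\hat r_i=(D_i-\hat\mu(X_i))\psi(\hat\Delta(X_i))$. **Theorem.**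 Assume that $f_{\rm rct}(x)=0$ for $\lambda$-almost all $x$ with $f_{\rm obs}(x)=0$; that $E_{\rm rct}[D^2]<\infty$, $E_{\rm rct}\|\psi(\Delta(X))\|^2<\infty$, $E_{\rm obs}\|\psi(\Delta(X))\|^2<\infty$ and $E_{\rm rct}[(D-\bar\mu(X))^2\|\psi(\Delta(X))\|^2]<\infty$; that $E_{\rm rct}[\psi(\Delta(X))\psi(\Delta(X))^\top]$ is invertible; that $n,N\to\infty$ with $n/N\to0$; and that for all $j=1,\dots,p$ and $k=1,\dots,K$ $$\|\psi_j\circ\hat\Delta-\psi_j\circ\Delta\|_{L^2({\rm rct})}+\|\psi_j\circ\hat\Delta^{(-k)}-\psi_j\circ\Delta\|_{L^2({\rm obs})}=o_p(n^{-1/2}),$$ the norms being with respect to the distributions of $X$. Then $$\sqrt n(\hat{\bar\tau}-\bar\tau)\xrightarrow{d}\mathcal N(0,\Sigma),\qquad \Sigma=\bar\alpha^\top E_{\rm rct}\big[(D-\bar\mu(X))^2\psi(\Delta(X))\psi(\Delta(X))^\top\big]\bar\alpha,$$ where $\bar\alpha=\big(E_{\rm rct}[\psi(\Delta(X))\psi(\Delta(X))^\top]\big)^{-1}E_{\rm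 obs}[\psi(\Delta(X))]$. If in addition $\|\psi_j\circ\hat\Delta-\psi_j\circ\Delta\|_{L^{2+\epsilon}({\rm rct})}=o_p(1)$ for some $\epsilon>0$ and all $j$, $E_{\rm rct}[D^4]<\infty$, $E_{\rm rct}\|\psi(\Delta(X))\|^q<\infty$ for all $q<\infty$, and $$\liminf\Pr\Big(\int\|\psi(\hat\Delta(x))\|^q f_{\rm rct}(x)\,d\lambda(x)<\infty\ \text{for all } q<\infty\Big)=1,$$ then $n\hat V\to\Sigma$ in probability and, provided $\Sigma>0$, for every $\alpha\in(0,1)$, $$\liminf\Pr\Big(\hat{\bar\tau}-z_{1-\alpha/2}\sqrt{\hat V}\le\bar\tau\le\hat{\bar\tau}+z_{1-\alpha/2}\sqrt{\hat V}\Big)\ge1-\alpha,$$ where $z_{1-\alpha/2}$ is the $1-\alpha/2$ quantile of the standard normal distribution. -/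

import Mathlib

open MeasureTheory ProbabilityTheory Filter Topology
open scoped ENNReal NNReal Matrix

/-! ## Population quantities

An experimental unit is a pair `(D, X) : ℝ × 𝓧`, an observational unit is a triple
`(X, Z, Y) : 𝓧 × Bool × ℝ`. -/

/-- `Δ` is a version of the observational treatment-control contrast
`x ↦ E_obs[Y | X = x, Z = 1] - E_obs[Y | X = x, Z = 0]`: there is a measurable regression function
`m` with `E_obs[Y | X, Z] = m (X, Z)` almost surely, and `Δ x = m (x, 1) - m (x, 0)`. -/
def IsTreatmentContrast {𝓧 : Type*} [MeasurableSpace 𝓧] (Pobs : Measure (𝓧 × Bool × ℝ))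
    (Δ : 𝓧 → ℝ) : Prop :=
  Integrable (fun o : 𝓧 × Bool × ℝ => o.2.2) Pobs ∧
  ∃ m : 𝓧 × Bool → ℝ, Measurable m ∧
    Pobs[fun o : 𝓧 × Bool × ℝ => o.2.2 |
        MeasurableSpace.comap (fun o : 𝓧 × Bool × ℝ => (o.1, o.2.1)) inferInstance]
      =ᵐ[Pobs] (fun o : 𝓧 × Bool × ℝ => m (o.1, o.2.1)) ∧
    ∀ x, Δ x = m (x, true) - m (x, false)

/-- The calibrated value `βᵀ ψ(z)`. -/
noncomputable def calibrate {p : ℕ} (ψ : ℝ → EuclideanSpace ℝ (Fin p)) (β : Fin p → ℝ) (z : ℝ) :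
    ℝ :=
  ∑ j, β j * ψ z j

/-- The class `𝓕 = {x ↦ βᵀ ψ(Δ(x)) : β ∈ ℝᵖ}`. -/
def calibrationClass {𝓧 : Type*} {p : ℕ} (ψ : ℝ → EuclideanSpace ℝ (Fin p)) (Δ : 𝓧 → ℝ) :
    Set (𝓧 → ℝ) :=
  {f | ∃ β : Fin p → ℝ, f = fun x => calibrate ψ β (Δ x)}

/-- `μbar` is a minimizer over `f ∈ 𝓕` of `E_rct[(D - f(X))²]`. -/
def IsBestCalibration {𝓧 : Type*} [MeasurableSpace 𝓧] {p : ℕ} (Prct : Measure (ℝ × 𝓧))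
    (ψ : ℝ → EuclideanSpace ℝ (Fin p)) (Δ : 𝓧 → ℝ) (μbar : 𝓧 → ℝ) : Prop :=
  μbar ∈ calibrationClass ψ Δ ∧
  IsMinOn (fun f : 𝓧 → ℝ => ∫ w, (w.1 - f w.2) ^ 2 ∂Prct) (calibrationClass ψ Δ) μbar

/-- The Gram matrix `E_ν[ψ(Δ(X)) ψ(Δ(X))ᵀ]`, for a covariate distribution `ν`. -/
noncomputable def gramMatrix {𝓧 : Type*} [MeasurableSpace 𝓧] {p : ℕ} (ν : Measure 𝓧)
    (ψ : ℝ → EuclideanSpace ℝ (Fin p)) (Δ : 𝓧 → ℝ) : Matrix (Fin p) (Fin p) ℝ :=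
  Matrix.of fun i j => ∫ x, ψ (Δ x) i * ψ (Δ x) j ∂ν

/-- The vector `E_rct[ψ(Δ(X)) ψ(Δ(X))ᵀ]⁻¹ E_obs[ψ(Δ(X))]`, for covariate distributions `νrct` and
`νobs`. -/
noncomputable def alphaBar {𝓧 : Type*} [MeasurableSpace 𝓧] {p : ℕ} (νrct νobs : Measure 𝓧)
    (ψ : ℝ → EuclideanSpace ℝ (Fin p)) (Δ : 𝓧 → ℝ) : Fin p → ℝ :=
  (gramMatrix νrct ψ Δ)⁻¹ *ᵥ fun j => ∫ x, ψ (Δ x) j ∂νobs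

/-- The matrix `E_rct[(D - μbar(X))² ψ(Δ(X)) ψ(Δ(X))ᵀ]`. -/
noncomputable def meatMatrix {𝓧 : Type*} [MeasurableSpace 𝓧] {p : ℕ} (Prct : Measure (ℝ × 𝓧))
    (ψ : ℝ → EuclideanSpace ℝ (Fin p)) (Δ μbar : 𝓧 → ℝ) : Matrix (Fin p) (Fin p) ℝ :=
  Matrix.of fun i j => ∫ w, (w.1 - μbar w.2) ^ 2 * (ψ (Δ w.2) i * ψ (Δ w.2) j) ∂Prct

/-- The asymptotic variance `Σ = αbarᵀ E_rct[(D - μbar(X))² ψ(Δ(X)) ψ(Δ(X))ᵀ] αbar`. -/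
noncomputable def asympVar {𝓧 : Type*} [MeasurableSpace 𝓧] {p : ℕ} (Prct : Measure (ℝ × 𝓧))
    (Pobs : Measure (𝓧 × Bool × ℝ)) (ψ : ℝ → EuclideanSpace ℝ (Fin p)) (Δ μbar : 𝓧 → ℝ) : ℝ :=
  alphaBar (Prct.map Prod.snd) (Pobs.map Prod.fst) ψ Δ ⬝ᵥ
    (meatMatrix Prct ψ Δ μbar *ᵥ alphaBar (Prct.map Prod.snd) (Pobs.map Prod.fst) ψ Δ)

/-! ## Sampling and cross-fitting -/

/-- Data of sizes `n` (experimental) and `N` (observational) together with a `K`-fold cross-fitting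
scheme. The experimental units are i.i.d. from `Prct`, the observational units are i.i.d. from
`Pobs`, the two samples are independent, and the random balanced partition into folds and the
internal randomness `seed` of the learner are independent of the data. The learner maps a fold
label, a seed and a sample indexed by a set `S` of observational indices to a function on `𝓧`. -/
structure CrossFitSample {Ω 𝓧 : Type*} [MeasurableSpace Ω] [MeasurableSpace 𝓧]
    (𝓤 : Type*) [MeasurableSpace 𝓤] (P : Measure Ω) (Prct : Measure (ℝ × 𝓧))
    (Pobs : Measure (𝓧 × Bool × ℝ)) (n N K : ℕ) where
  /-- the experimental units `(D_i, X_i)` -/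
  rct : Fin n → Ω → ℝ × 𝓧
  /-- the observational units `(X_i, Z_i, Y_i)` -/
  obs : Fin N → Ω → 𝓧 × Bool × ℝ
  /-- the fold containing each observational index -/
  fold : Ω → Fin N → Fin K
  /-- internal randomness of the learner -/
  seed : Ω → 𝓤
  /-- the learner of the treatment-control contrast -/
  learner : Fin K → 𝓤 → (S : Finset (Fin N)) → (S → 𝓧 × Bool × ℝ) → 𝓧 → ℝ
  measurable_rct : ∀ i, Measurable (rct i)
  measurable_obs : ∀ i, Measurable (obs i)
  measurable_fold : Measurable fold
  measurable_seed : Measurable seed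
  measurable_learner : ∀ (k : Fin K) (S : Finset (Fin N)),
    Measurable fun q : 𝓤 × (S → 𝓧 × Bool × ℝ) × 𝓧 => learner k q.1 S q.2.1 q.2.2
  law_rct : ∀ i, P.map (rct i) = Prct
  law_obs : ∀ i, P.map (obs i) = Pobs
  indep_rct : iIndepFun rct P
  indep_obs : iIndepFun obs P
  indep_rct_rest :
    IndepFun (fun ω i => rct i ω) (fun ω => ((fun i => obs i ω), fold ω, seed ω)) P
  indep_obs_aux : IndepFun (fun ω i => obs i ω) (fun ω => (fold ω, seed ω)) P
  balanced : ∀ ω k l, (Finset.univ.filter fun i => fold ω i = k).card ≤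
    (Finset.univ.filter fun i => fold ω i = l).card + 1

namespace CrossFitSample

/-- The fold `𝓘_k`. -/
def foldSet {Ω 𝓧 𝓤 : Type*} [MeasurableSpace Ω] [MeasurableSpace 𝓧] [MeasurableSpace 𝓤]
    {P : Measure Ω} {Prct : Measure (ℝ × 𝓧)} {Pobs : Measure (𝓧 × Bool × ℝ)} {n N K : ℕ}
    (s : CrossFitSample 𝓤 P Prct Pobs n N K) (ω : Ω) (k : Fin K) : Finset (Fin N) :=
  Finset.univ.filter fun i => s.fold ω i = k

/-- The cross-fit estimate `Δhat^(-k)`, computed from the observational units outside fold `k`. -/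
def contrastCF {Ω 𝓧 𝓤 : Type*} [MeasurableSpace Ω] [MeasurableSpace 𝓧] [MeasurableSpace 𝓤]
    {P : Measure Ω} {Prct : Measure (ℝ × 𝓧)} {Pobs : Measure (𝓧 × Bool × ℝ)} {n N K : ℕ}
    (s : CrossFitSample 𝓤 P Prct Pobs n N K) (k : Fin K) (ω : Ω) : 𝓧 → ℝ :=
  s.learner k (s.seed ω) (s.foldSet ω k)ᶜ fun i => s.obs i ω

/-- The averaged estimate `Δhat = K⁻¹ ∑ₖ Δhat^(-k)`. -/
noncomputable def contrastAvg {Ω 𝓧 𝓤 : Type*} [MeasurableSpace Ω] [MeasurableSpace 𝓧]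
    [MeasurableSpace 𝓤] {P : Measure Ω} {Prct : Measure (ℝ × 𝓧)} {Pobs : Measure (𝓧 × Bool × ℝ)}
    {n N K : ℕ} (s : CrossFitSample 𝓤 P Prct Pobs n N K) (ω : Ω) (x : 𝓧) : ℝ :=
  (K : ℝ)⁻¹ * ∑ k, s.contrastCF k ω x

/-- `b` is an ordinary least squares coefficient in the regression of `D_i` on `ψ(Δhat(X_i))` in the
experimental sample. -/
def IsOLS {Ω 𝓧 𝓤 : Type*} [MeasurableSpace Ω] [MeasurableSpace 𝓧] [MeasurableSpace 𝓤]
    {P : Measure Ω} {Prct : Measure (ℝ × 𝓧)} {Pobs : Measure (𝓧 × Bool × ℝ)} {n N K : ℕ}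
    (s : CrossFitSample 𝓤 P Prct Pobs n N K) {p : ℕ} (ψ : ℝ → EuclideanSpace ℝ (Fin p))
    (ω : Ω) (b : Fin p → ℝ) : Prop :=
  ∀ b' : Fin p → ℝ,
    ∑ i, ((s.rct i ω).1 - calibrate ψ b (s.contrastAvg ω (s.rct i ω).2)) ^ 2 ≤
      ∑ i, ((s.rct i ω).1 - calibrate ψ b' (s.contrastAvg ω (s.rct i ω).2)) ^ 2

/-- The point estimate
`τhat = N⁻¹ ∑ₖ ∑_{i ∈ 𝓘_k} bᵀ ψ(Δhat^(-k)(X_i))` built from the coefficient `b`. -/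
noncomputable def tauHat {Ω 𝓧 𝓤 : Type*} [MeasurableSpace Ω] [MeasurableSpace 𝓧]
    [MeasurableSpace 𝓤] {P : Measure Ω} {Prct : Measure (ℝ × 𝓧)} {Pobs : Measure (𝓧 × Bool × ℝ)}
    {n N K : ℕ} (s : CrossFitSample 𝓤 P Prct Pobs n N K) {p : ℕ}
    (ψ : ℝ → EuclideanSpace ℝ (Fin p)) (b : Fin p → ℝ) (ω : Ω) : ℝ :=
  (N : ℝ)⁻¹ * ∑ k, ∑ i ∈ s.foldSet ω k, calibrate ψ b (s.contrastCF k ω (s.obs i ω).1)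

/-- The empirical Gram matrix `n⁻¹ ∑ᵢ ψ(Δhat(X_i)) ψ(Δhat(X_i))ᵀ`. -/
noncomputable def gramHat {Ω 𝓧 𝓤 : Type*} [MeasurableSpace Ω] [MeasurableSpace 𝓧]
    [MeasurableSpace 𝓤] {P : Measure Ω} {Prct : Measure (ℝ × 𝓧)} {Pobs : Measure (𝓧 × Bool × ℝ)}
    {n N K : ℕ} (s : CrossFitSample 𝓤 P Prct Pobs n N K) {p : ℕ}
    (ψ : ℝ → EuclideanSpace ℝ (Fin p)) (ω : Ω) : Matrix (Fin p) (Fin p) ℝ :=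
  Matrix.of fun j l => (n : ℝ)⁻¹ *
    ∑ i, ψ (s.contrastAvg ω (s.rct i ω).2) j * ψ (s.contrastAvg ω (s.rct i ω).2) l

/-- The vector `ahat = gramHat⁻¹ (N⁻¹ ∑ₖ ∑_{i ∈ 𝓘_k} ψ(Δhat^(-k)(X_i)))`. -/
noncomputable def aHat {Ω 𝓧 𝓤 : Type*} [MeasurableSpace Ω] [MeasurableSpace 𝓧]
    [MeasurableSpace 𝓤] {P : Measure Ω} {Prct : Measure (ℝ × 𝓧)} {Pobs : Measure (𝓧 × Bool × ℝ)}
    {n N K : ℕ} (s : CrossFitSample 𝓤 P Prct Pobs n N K) {p : ℕ}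
    (ψ : ℝ → EuclideanSpace ℝ (Fin p)) (ω : Ω) : Fin p → ℝ :=
  (s.gramHat ψ ω)⁻¹ *ᵥ fun j =>
    (N : ℝ)⁻¹ * ∑ k, ∑ i ∈ s.foldSet ω k, ψ (s.contrastCF k ω (s.obs i ω).1) j

/-- The vectors `rhat_i = (D_i - bᵀ ψ(Δhat(X_i))) ψ(Δhat(X_i))`. -/
noncomputable def rHat {Ω 𝓧 𝓤 : Type*} [MeasurableSpace Ω] [MeasurableSpace 𝓧]
    [MeasurableSpace 𝓤] {P : Measure Ω} {Prct : Measure (ℝ × 𝓧)} {Pobs : Measure (𝓧 × Bool × ℝ)}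
    {n N K : ℕ} (s : CrossFitSample 𝓤 P Prct Pobs n N K) {p : ℕ}
    (ψ : ℝ → EuclideanSpace ℝ (Fin p)) (b : Fin p → ℝ) (ω : Ω) (i : Fin n) : Fin p → ℝ :=
  fun j => ((s.rct i ω).1 - calibrate ψ b (s.contrastAvg ω (s.rct i ω).2)) *
    ψ (s.contrastAvg ω (s.rct i ω).2) j

/-- The variance estimate
`Vhat = ahatᵀ (n⁻² ∑ᵢ rhat_i rhat_iᵀ) ahat
  + N⁻² ∑ₖ ∑_{i ∈ 𝓘_k} (bᵀ ψ(Δhat^(-k)(X_i)) - τhat)²`. -/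
noncomputable def VHat {Ω 𝓧 𝓤 : Type*} [MeasurableSpace Ω] [MeasurableSpace 𝓧]
    [MeasurableSpace 𝓤] {P : Measure Ω} {Prct : Measure (ℝ × 𝓧)} {Pobs : Measure (𝓧 × Bool × ℝ)}
    {n N K : ℕ} (s : CrossFitSample 𝓤 P Prct Pobs n N K) {p : ℕ}
    (ψ : ℝ → EuclideanSpace ℝ (Fin p)) (b : Fin p → ℝ) (ω : Ω) : ℝ :=
  s.aHat ψ ω ⬝ᵥ
      ((((n : ℝ) ^ 2)⁻¹ • ∑ i, Matrix.vecMulVec (s.rHat ψ b ω i) (s.rHat ψ b ω i)) *ᵥ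
        s.aHat ψ ω) +
    ((N : ℝ) ^ 2)⁻¹ * ∑ k, ∑ i ∈ s.foldSet ω k,
      (calibrate ψ b (s.contrastCF k ω (s.obs i ω).1) - s.tauHat ψ b ω) ^ 2

end CrossFitSample

/-! ## Asymptotic notions -/

/-- `R_t = o_p(r_t)` for nonnegative, possibly infinite random quantities `R_t` and rates `r_t`. -/
def IsLittleOp {Ω : Type*} [MeasurableSpace Ω] (P : Measure Ω) (R : ℕ → Ω → ℝ≥0∞) (r : ℕ → ℝ) :
    Prop :=
  ∀ ε : ℝ, 0 < ε → Tendsto (fun t => P {ω | ENNReal.ofReal (ε * r t) < R t ω}) atTop (𝓝 0)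

/-- The quantile function of the standard normal distribution. -/
noncomputable def stdNormalQuantile (q : ℝ) : ℝ :=
  sInf {x : ℝ | q ≤ cdf (gaussianReal 0 1) x}

/-! Write `φ = ψ ∘ Δ`, `μbar = β₀ᵀφ` and `e = D - μbar(X)`. Minimality of `μbar` gives the
population normal equations `E_rct[e φ] = 0`. Put `G = E_rct[φφᵀ]` and `b = E_obs[φ]`, so that the
target is `β₀ᵀb`; the estimator is `βᵀb̂`, where `b̂` is the mean of the cross-fit regressors over
the observational sample.

The estimated regressors at the experimental units are `φ + δ`. The learner never sees the
experimental data, so given the observational data the expected sum of `δ_j²` over these units is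
`n` times a squared L² error. The rate `o_p(n^(-1/2))` makes it vanish: the whole sum of squares
tends to zero, not merely its average (`RegressorRate.sumSqNull_rctError`). Cross-fitting gives the
analogous bound at the observational units: a unit in fold `k` is independent of everything that the
learner for that fold reads (`CrossFitSample.setLIntegral_fold_le`). Together with `n/N → 0`, this
yields `√n (b̂ - b) → 0` (`RegressorRate.sqrt_mul_obsMean_sub`).

The sample normal equations read `Ĝ √n(β - β₀) = score + remainder`, with `score = n^(-1/2) ∑ e φ`.
The remainder is linear in `δ` up to bounded factors and vanishes by Cauchy–Schwarz, and `Ĝ → G`.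
Hence `√n(βᵀb̂ - β₀ᵀb) = scoreᵀ G⁻¹ b + o_p(1)` (`PerturbedLS.tendsto_sqrt_mul_sub_scaledScore`).
The central limit theorem applies to this linear term, whose variance is the sandwich `asympVar`.

In `n · VHat`, the first term is a plug-in sandwich and converges by the law of large numbers
(`PerturbedLS.tendsto_meat`); the second is `n/N` times a bounded mean square. Coverage then follows
from normality and consistency (`le_liminf_coverage`).

Convergence in probability is expressed as convergence along one filter on `ℕ × Ω`, so that the
`o_p` calculus becomes ordinary limit calculus. The least squares expansion is purely deterministic
and holds along any filter. -/

/-! ## Convergence in probability as convergence along a filter -/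

/-- The filter on `ℕ × Ω` of the families of events whose probability tends to one. Convergence
along it is convergence in probability. -/
def probFilter {Ω : Type*} [MeasurableSpace Ω] (P : Measure Ω) : Filter (ℕ × Ω) where
  sets := {A | Tendsto (fun t => P {ω | (t, ω) ∉ A}) atTop (𝓝 0)}
  univ_sets := by simp
  sets_of_superset := by
    intro A B hA hAB
    refine tendsto_of_tendsto_of_tendsto_of_le_of_le tendsto_const_nhds hA (fun _ => zero_le) ?_
    exact fun t => measure_mono fun ω hω h => hω (hAB h)
  inter_sets := by
    intro A B hA hB
    have h := hA.add hB
    rw [add_zero] at h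
    refine tendsto_of_tendsto_of_tendsto_of_le_of_le tendsto_const_nhds h (fun _ => zero_le) ?_
    refine fun t => (measure_mono fun ω hω => ?_).trans (measure_union_le _ _)
    simpa only [Set.mem_union, Set.mem_ofPred_eq, Set.mem_inter_iff, not_and_or] using hω

section probFilter

variable {Ω : Type*} [MeasurableSpace Ω] {P : Measure Ω}

lemma eventually_probFilter {p : ℕ × Ω → Prop} :
    (∀ᶠ z in probFilter P, p z) ↔ Tendsto (fun t => P {ω | ¬ p (t, ω)}) atTop (𝓝 0) := Iff.rfl

lemma eventually_probFilter_of_le {p : ℕ × Ω → Prop} {u : ℕ → ℝ≥0∞}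
    (h : ∀ᶠ t in atTop, P {ω | ¬ p (t, ω)} ≤ u t) (hu : Tendsto u atTop (𝓝 0)) :
    ∀ᶠ z in probFilter P, p z :=
  tendsto_of_tendsto_of_tendsto_of_le_of_le' tendsto_const_nhds hu
    (Eventually.of_forall fun _ => zero_le) h

/-- It suffices to bound the probability of failure by an arbitrarily small constant plus a null
sequence. -/
lemma eventually_probFilter_of_forall_le_add {p : ℕ × Ω → Prop}
    (h : ∀ η : ℝ, 0 < η → ∃ u : ℕ → ℝ≥0∞, Tendsto u atTop (𝓝 0) ∧
      ∀ᶠ t in atTop, P {ω | ¬ p (t, ω)} ≤ u t + ENNReal.ofReal η) :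
    ∀ᶠ z in probFilter P, p z := by
  rw [eventually_probFilter, ENNReal.tendsto_nhds_zero]
  intro ε hε
  obtain ⟨η, hη, hηε⟩ : ∃ η : ℝ, 0 < η ∧ ENNReal.ofReal η + ENNReal.ofReal η ≤ ε := by
    by_cases hε' : ε = ∞
    · exact ⟨1, one_pos, by simp [hε']⟩
    · have := ENNReal.toReal_pos hε.ne' hε'
      refine ⟨ε.toReal / 2, by positivity, ?_⟩
      rw [← ENNReal.ofReal_add (by positivity) (by positivity), add_halves,
        ENNReal.ofReal_toReal hε']
  obtain ⟨u, hu, hle⟩ := h η hη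
  filter_upwards [hle, (ENNReal.tendsto_nhds_zero.1 hu) _ (ENNReal.ofReal_pos.2 hη)] with t h1 h2
  exact h1.trans ((by gcongr : _ ≤ ENNReal.ofReal η + ENNReal.ofReal η).trans hηε)

/-- Deterministic limits in `t` transfer to the filter, since for large `t` the exceptional event is
empty. -/
lemma tendsto_fst_probFilter : Tendsto Prod.fst (probFilter P) atTop := by
  rw [tendsto_atTop]
  intro a
  refine eventually_probFilter_of_le (u := fun _ => 0) ?_ tendsto_const_nhds
  filter_upwards [eventually_ge_atTop a] with t ht
  simp [ht]

lemma tendstoInMeasure_const_iff {E : Type*} [PseudoMetricSpace E] {f : ℕ → Ω → E} {c : E} :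
    TendstoInMeasure P f atTop (fun _ => c) ↔
      Tendsto (fun z : ℕ × Ω => f z.1 z.2) (probFilter P) (𝓝 c) := by
  rw [tendstoInMeasure_iff_dist, Metric.tendsto_nhds]
  simp only [eventually_probFilter, not_lt]

/-- Boundedness in probability, uniformly along the sequence. -/
def BddInProb (P : Measure Ω) (X : ℕ × Ω → ℝ) : Prop :=
  ∀ δ : ℝ, 0 < δ → ∃ M : ℝ, ∀ t, P {ω | M < |X (t, ω)|} ≤ ENNReal.ofReal δ

/-- This is `O_p(1) · o_p(1) = o_p(1)`: off an event of probability at most `η` the factor `X` is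
bounded by a constant, and `η` is arbitrary. The bound `|M| + 1` is used because `M` may fail to be
positive. -/
lemma BddInProb.mul_tendsto_zero {X Y : ℕ × Ω → ℝ} (hX : BddInProb P X)
    (hY : Tendsto Y (probFilter P) (𝓝 0)) :
    Tendsto (fun z => X z * Y z) (probFilter P) (𝓝 0) := by
  rw [Metric.tendsto_nhds]
  intro ε hε
  refine eventually_probFilter_of_forall_le_add fun η hη => ?_
  obtain ⟨M, hM⟩ := hX η hη
  have hM' : 0 < |M| + 1 := by positivity
  refine ⟨_, eventually_probFilter.1 (Metric.tendsto_nhds.1 hY (ε / (|M| + 1)) (by positivity)),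
    Eventually.of_forall fun t => ?_⟩
  refine le_trans (measure_mono fun ω hω => ?_) ((measure_union_le _ _).trans
    (add_le_add_right (hM t) _))
  simp only [Set.mem_union, Set.mem_ofPred_eq, dist_zero_right, Real.norm_eq_abs, not_lt,
    abs_mul] at hω ⊢
  by_contra! hcon
  refine hω.not_gt ?_
  calc |X (t, ω)| * |Y (t, ω)| ≤ (|M| + 1) * |Y (t, ω)| := by
        gcongr
        linarith [hcon.2, le_abs_self M]
    _ < (|M| + 1) * (ε / (|M| + 1)) := by gcongr; exact hcon.1
    _ = ε := by field_simp

end probFilter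

/-! ## Rows of i.i.d. samples -/

/-- For every `t`, the variables `X t i`, `i < m t`, are i.i.d. with law `Q`. -/
structure IIDRows {Ω E : Type*} [MeasurableSpace Ω] [MeasurableSpace E] (P : Measure Ω)
    (Q : Measure E) (m : ℕ → ℕ) (X : ∀ t, Fin (m t) → Ω → E) : Prop where
  measurable : ∀ t i, Measurable (X t i)
  law : ∀ t i, P.map (X t i) = Q
  indep : ∀ t, iIndepFun (X t) P

namespace IIDRows

variable {Ω E : Type*} [MeasurableSpace Ω] [MeasurableSpace E] {P : Measure Ω}
  [IsProbabilityMeasure P] {Q : Measure E} [IsProbabilityMeasure Q] {m : ℕ → ℕ}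
  {X : ∀ t, Fin (m t) → Ω → E}

/-- A statistic of a row has the law of the same statistic of the first coordinates of an infinite
i.i.d. sequence. -/
lemma map_row_eq (h : IIDRows P Q m X) (t : ℕ) {F : Type*} [MeasurableSpace F]
    {g : (Fin (m t) → E) → F} (hg : Measurable g) :
    P.map (fun ω => g fun i => X t i ω) =
      (Measure.infinitePi fun _ : ℕ => Q).map (fun w => g fun i => w i) := by
  have h1 : P.map (fun ω i => X t i ω) = Measure.pi fun _ => Q := by
    rw [(iIndepFun_iff_map_fun_eq_pi_map fun i => (h.measurable t i).aemeasurable).1 (h.indep t)]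
    simp only [h.law t]
  have h2 := Measure.map_infinitePi_infinitePi_of_inj (P := fun _ : ℕ => Q)
    (f := fun i : Fin (m t) => (i : ℕ)) Fin.val_injective
  rw [Measure.infinitePi_eq_pi (ι := Fin (m t)), ← h1] at h2
  have hX : Measurable fun ω i => X t i ω := measurable_pi_lambda _ fun i => h.measurable t i
  calc P.map (fun ω => g fun i => X t i ω) = (P.map fun ω i => X t i ω).map g :=
        (Measure.map_map hg hX).symm
    _ = _ := by rw [← h2, Measure.map_map hg (by fun_prop)]; rfl

/-- **Weak law of large numbers** for rows. -/
lemma tendsto_mean (h : IIDRows P Q m X) (hm : Tendsto m atTop atTop) {f : E → ℝ}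
    (hf : Measurable f) (hint : Integrable f Q) :
    Tendsto (fun z : ℕ × Ω => (m z.1 : ℝ)⁻¹ * ∑ i, f (X z.1 i z.2)) (probFilter P)
      (𝓝 (∫ x, f x ∂Q)) := by
  -- Different rows need not be parts of one sequence. The strong law is therefore applied to an
  -- auxiliary i.i.d. sequence; convergence in probability to a constant depends only on the law of
  -- each row, so it transfers back through `map_row_eq`.
  set W := Measure.infinitePi fun _ : ℕ => Q with hW
  have hmap : ∀ i : ℕ, W.map (fun w => w i) = Q := fun i => Measure.infinitePi_map_eval _ i
  have hind : iIndepFun (fun (i : ℕ) (w : ℕ → E) => f (w i)) W :=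
    iIndepFun_infinitePi (X := fun _ => f) fun _ => hf
  have hfi : ∀ i : ℕ, Measurable fun w : ℕ → E => f (w i) := fun i =>
    hf.comp (measurable_pi_apply i)
  have hid : ∀ i : ℕ, IdentDistrib (fun w : ℕ → E => f (w i)) (fun w => f (w 0)) W W := fun i =>
    IdentDistrib.comp (u := f) ⟨(measurable_pi_apply i).aemeasurable,
      (measurable_pi_apply 0).aemeasurable, by rw [hmap, hmap]⟩ hf
  have hint0 : Integrable (fun w : ℕ → E => f (w 0)) W := by
    have := hint
    rw [← hmap 0] at this
    exact this.comp_measurable (measurable_pi_apply 0)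
  have hmean : ∫ w, f (w 0) ∂W = ∫ x, f x ∂Q := by
    rw [← hmap 0, integral_map (measurable_pi_apply 0).aemeasurable hf.aestronglyMeasurable]
  have hae := strong_law_ae_real (fun (i : ℕ) (w : ℕ → E) => f (w i)) hint0
    (fun i j hij => hind.indepFun hij) hid
  have hmeas : TendstoInMeasure W
      (fun (n : ℕ) (w : ℕ → E) => (∑ i ∈ Finset.range n, f (w i)) / n) atTop
      (fun _ => ∫ x, f x ∂Q) := by
    refine tendstoInMeasure_of_tendsto_ae (fun n => ?_) (by simpa only [hmean] using hae)
    exact ((Finset.measurable_sum _ fun i _ => hfi i).div_const _).aestronglyMeasurable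
  rw [← tendstoInMeasure_const_iff (f := fun t ω => (m t : ℝ)⁻¹ * ∑ i, f (X t i ω)),
    tendstoInMeasure_iff_dist]
  rw [tendstoInMeasure_iff_dist] at hmeas
  intro ε hε
  refine ((hmeas ε hε).comp hm).congr fun t => ?_
  have hg : Measurable fun w : Fin (m t) → E => (m t : ℝ)⁻¹ * ∑ i, f (w i) := by fun_prop
  have hset : MeasurableSet {y : ℝ | ε ≤ dist y (∫ x, f x ∂Q)} :=
    measurableSet_le measurable_const (by fun_prop)
  have key := congrArg (fun μ => μ {y : ℝ | ε ≤ dist y (∫ x, f x ∂Q)}) (h.map_row_eq t hg)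
  simp only at key
  have hgX : Measurable fun ω => (m t : ℝ)⁻¹ * ∑ i, f (X t i ω) :=
    hg.comp (measurable_pi_lambda _ fun i => h.measurable t i)
  rw [Measure.map_apply hgX hset, Measure.map_apply (by fun_prop) hset] at key
  simp only [Set.preimage_ofPred_eq] at key
  rw [key]
  simp only [Function.comp, ← hW, Finset.sum_range, div_eq_inv_mul]

omit [IsProbabilityMeasure P] [IsProbabilityMeasure Q] in
lemma memLp_comp (h : IIDRows P Q m X) {f : E → ℝ} {q : ℝ≥0∞} (hL : MemLp f q Q) (t : ℕ)
    (i : Fin (m t)) : MemLp (fun ω => f (X t i ω)) q P := by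
  rw [← h.law t i] at hL
  exact hL.comp_of_map (h.measurable t i).aemeasurable

omit [IsProbabilityMeasure Q] in
/-- **Chebyshev's inequality** for centered rows. -/
lemma bddInProb (h : IIDRows P Q m X) {f : E → ℝ} (hf : Measurable f)
    (hL : MemLp f 2 Q) (h0 : ∫ x, f x ∂Q = 0) :
    BddInProb P fun z : ℕ × Ω => (√(m z.1 : ℝ))⁻¹ * ∑ i, f (X z.1 i z.2) := by
  intro δ hδ
  set V := Var[f; Q]
  have hV : 0 ≤ V := variance_nonneg _ _
  -- With this choice `V / c² = δ V / (V + 1) ≤ δ`; the summand 1 keeps `c` positive when `V = 0`.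
  set c := √((V + 1) / δ)
  have hc : 0 < c := by positivity
  refine ⟨c, fun t => ?_⟩
  have hlp := h.memLp_comp hL t
  have hsum : MemLp (fun ω => (√(m t : ℝ))⁻¹ * ∑ i, f (X t i ω)) 2 P :=
    (memLp_finsetSum _ fun i _ => hlp i).const_mul _
  have hmean : ∫ ω, (√(m t : ℝ))⁻¹ * ∑ i, f (X t i ω) ∂P = 0 := by
    rw [integral_const_mul, integral_finsetSum _ fun i _ => (hlp i).integrable one_le_two,
      Finset.sum_eq_zero, mul_zero]
    intro i _
    rw [← h0, ← h.law t i, integral_map (h.measurable t i).aemeasurable hf.aestronglyMeasurable]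
  have hvar : Var[fun ω => (√(m t : ℝ))⁻¹ * ∑ i, f (X t i ω); P] ≤ V := by
    rw [variance_const_mul]
    have h1 : Var[∑ i, fun ω => f (X t i ω); P] = ∑ i, Var[fun ω => f (X t i ω); P] :=
      IndepFun.variance_sum (fun i _ => hlp i) fun i _ j _ hij =>
        ((h.indep t).indepFun hij).comp hf hf
    have h2 : ∀ i, Var[fun ω => f (X t i ω); P] = V := by
      intro i
      simp only [V]
      rw [← h.law t i, variance_map hf.aemeasurable (h.measurable t i).aemeasurable]
      rfl
    have h3 : (fun ω => ∑ i, f (X t i ω)) = ∑ i, fun ω => f (X t i ω) := by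
      ext ω; simp
    rw [h3, h1, Finset.sum_congr rfl fun i _ => h2 i, Finset.sum_const, Finset.card_univ,
      Fintype.card_fin, nsmul_eq_mul, inv_pow, Real.sq_sqrt (Nat.cast_nonneg _), ← mul_assoc]
    rcases Nat.eq_zero_or_pos (m t) with hm | hm
    · simp [hm, hV]
    · rw [inv_mul_cancel₀ (by positivity), one_mul]
  have hch := meas_ge_le_variance_div_sq hsum hc
  rw [hmean] at hch
  refine (measure_mono fun ω hω => ?_).trans (hch.trans (ENNReal.ofReal_le_ofReal ?_))
  · simp only [Set.mem_ofPred_eq, sub_zero] at hω ⊢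
    exact hω.le
  · rw [div_le_iff₀ (by positivity), Real.sq_sqrt (by positivity), mul_div_cancel₀ _ hδ.ne']
    linarith

/-- **Central limit theorem** for centered rows. -/
lemma tendstoInDistribution (h : IIDRows P Q m X) (hm : Tendsto m atTop atTop) {f : E → ℝ}
    (hf : Measurable f) (hL : MemLp f 2 Q) (h0 : ∫ x, f x ∂Q = 0) :
    TendstoInDistribution (fun t ω => (√(m t : ℝ))⁻¹ * ∑ i, f (X t i ω)) atTop (id : ℝ → ℝ)
      (fun _ => P) (gaussianReal 0 Var[f; Q].toNNReal) := by
  set W := Measure.infinitePi fun _ : ℕ => Q with hW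
  have hmap : ∀ i : ℕ, W.map (fun w => w i) = Q := fun i => Measure.infinitePi_map_eval _ i
  have hind : iIndepFun (fun (i : ℕ) (w : ℕ → E) => f (w i)) W :=
    iIndepFun_infinitePi (X := fun _ => f) fun _ => hf
  have hid : ∀ i : ℕ, IdentDistrib (fun w : ℕ → E => f (w i)) (fun w => f (w 0)) W W := fun i =>
    IdentDistrib.comp (u := f) ⟨(measurable_pi_apply i).aemeasurable,
      (measurable_pi_apply 0).aemeasurable, by rw [hmap, hmap]⟩ hf
  have hlp0 : MemLp (fun w : ℕ → E => f (w 0)) 2 W := by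
    have := hL
    rw [← hmap 0] at this
    exact this.comp_of_map (measurable_pi_apply 0).aemeasurable
  have hmean : ∫ w, f (w 0) ∂W = 0 := by
    rw [← h0, ← hmap 0, integral_map (measurable_pi_apply 0).aemeasurable hf.aestronglyMeasurable]
  have hvar : Var[fun w : ℕ → E => f (w 0); W] = Var[f; Q] := by
    rw [← hmap 0, variance_map hf.aemeasurable (measurable_pi_apply 0).aemeasurable]
    rfl
  have hlaw : HasLaw (id : ℝ → ℝ) (gaussianReal 0 Var[fun w : ℕ → E => f (w 0); W].toNNReal)
      (gaussianReal 0 Var[f; Q].toNNReal) := by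
    rw [hvar]
    exact HasLaw.id
  have clt := tendstoInDistribution_inv_sqrt_mul_sum_sub
    (X := fun (i : ℕ) (w : ℕ → E) => f (w i)) hlaw hlp0 hind hid
  simp only [hmean, mul_zero, sub_zero] at clt
  have hmeasX : ∀ t, Measurable fun ω => (√(m t : ℝ))⁻¹ * ∑ i, f (X t i ω) := fun t =>
    (Finset.measurable_sum _ fun i _ => hf.comp (h.measurable t i)).const_mul _
  refine ⟨fun t => (hmeasX t).aemeasurable, aemeasurable_id, ?_⟩
  refine (clt.tendsto.comp hm).congr fun t => ?_
  apply Subtype.ext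
  have hg : Measurable fun w : Fin (m t) → E => (√(m t : ℝ))⁻¹ * ∑ i, f (w i) := by fun_prop
  have := h.map_row_eq t hg
  simp only [Function.comp, Finset.sum_range]
  exact this.symm

end IIDRows

/-! ## Mean squares of arrays along a filter -/

section Arrays

variable {ι : Type*} {l : Filter ι} {m : ι → ℕ}

/-- The row mean squares of an array tend to zero. -/
def MeanSqNull (l : Filter ι) (a : ∀ z, Fin (m z) → ℝ) : Prop :=
  Tendsto (fun z => (m z : ℝ)⁻¹ * ∑ i, a z i ^ 2) l (𝓝 0)

/-- The row mean squares of an array are eventually bounded. -/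
def MeanSqBdd (l : Filter ι) (a : ∀ z, Fin (m z) → ℝ) : Prop :=
  ∃ C, ∀ᶠ z in l, (m z : ℝ)⁻¹ * ∑ i, a z i ^ 2 ≤ C

/-- The row sums of squares of an array tend to zero. -/
def SumSqNull (l : Filter ι) (a : ∀ z, Fin (m z) → ℝ) : Prop :=
  Tendsto (fun z => ∑ i, a z i ^ 2) l (𝓝 0)

variable {a b : ∀ z, Fin (m z) → ℝ}

lemma meanSq_nonneg (a : ∀ z, Fin (m z) → ℝ) (z : ι) : 0 ≤ (m z : ℝ)⁻¹ * ∑ i, a z i ^ 2 := by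
  positivity

lemma meanSq_add_le (a b : ∀ z, Fin (m z) → ℝ) (z : ι) :
    (m z : ℝ)⁻¹ * ∑ i, (a z i + b z i) ^ 2 ≤
      2 * ((m z : ℝ)⁻¹ * ∑ i, a z i ^ 2) + 2 * ((m z : ℝ)⁻¹ * ∑ i, b z i ^ 2) := by
  calc (m z : ℝ)⁻¹ * ∑ i, (a z i + b z i) ^ 2
      ≤ (m z : ℝ)⁻¹ * ∑ i, (2 * a z i ^ 2 + 2 * b z i ^ 2) := by
        gcongr with i
        nlinarith [sq_nonneg (a z i - b z i)]
    _ = _ := by rw [Finset.sum_add_distrib, ← Finset.mul_sum, ← Finset.mul_sum]; ring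

lemma meanSq_scalar_mul (c : ι → ℝ) (a : ∀ z, Fin (m z) → ℝ) (z : ι) :
    (m z : ℝ)⁻¹ * ∑ i, (c z * a z i) ^ 2 = c z ^ 2 * ((m z : ℝ)⁻¹ * ∑ i, a z i ^ 2) := by
  simp only [mul_pow, ← Finset.mul_sum]
  ring

lemma MeanSqNull.of_le {a : ∀ z, Fin (m z) → ℝ} {u : ι → ℝ}
    (h : ∀ᶠ z in l, (m z : ℝ)⁻¹ * ∑ i, a z i ^ 2 ≤ u z) (hu : Tendsto u l (𝓝 0)) :
    MeanSqNull l a :=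
  tendsto_of_tendsto_of_tendsto_of_le_of_le' tendsto_const_nhds hu
    (Eventually.of_forall fun z => meanSq_nonneg a z) h

lemma MeanSqNull.add (ha : MeanSqNull l a) (hb : MeanSqNull l b) :
    MeanSqNull l fun z i => a z i + b z i :=
  .of_le (Eventually.of_forall fun z => meanSq_add_le a b z)
    (by simpa using (Tendsto.const_mul 2 ha).add (Tendsto.const_mul 2 hb))

lemma MeanSqNull.neg (ha : MeanSqNull l a) : MeanSqNull l fun z i => -a z i := by
  simpa only [MeanSqNull, neg_sq] using ha

lemma MeanSqNull.sub (ha : MeanSqNull l a) (hb : MeanSqNull l b) :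
    MeanSqNull l fun z i => a z i - b z i := by
  simpa only [sub_eq_add_neg] using ha.add hb.neg

lemma MeanSqNull.sum {κ : Type*} (s : Finset κ) {f : κ → ∀ z, Fin (m z) → ℝ}
    (h : ∀ j ∈ s, MeanSqNull l (f j)) : MeanSqNull l fun z i => ∑ j ∈ s, f j z i := by
  classical
  induction s using Finset.induction_on with
  | empty => simp [MeanSqNull, tendsto_const_nhds]
  | insert j s hj ih =>
    simp only [Finset.sum_insert hj]
    exact (h j (Finset.mem_insert_self j s)).add
      (ih fun i hi => h i (Finset.mem_insert_of_mem hi))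

lemma MeanSqBdd.of_tendsto {c : ℝ} (h : Tendsto (fun z => (m z : ℝ)⁻¹ * ∑ i, a z i ^ 2) l (𝓝 c)) :
    MeanSqBdd l a :=
  ⟨c + 1, (h.eventually_lt_const (lt_add_one c)).mono fun _ h => h.le⟩

lemma MeanSqNull.meanSqBdd (h : MeanSqNull l a) : MeanSqBdd l a := .of_tendsto h

lemma MeanSqBdd.add (ha : MeanSqBdd l a) (hb : MeanSqBdd l b) :
    MeanSqBdd l fun z i => a z i + b z i := by
  obtain ⟨A, hA⟩ := ha
  obtain ⟨B, hB⟩ := hb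
  refine ⟨2 * A + 2 * B, ?_⟩
  filter_upwards [hA, hB] with z h1 h2
  exact (meanSq_add_le a b z).trans (by gcongr)

lemma MeanSqBdd.scalar_mul (ha : MeanSqBdd l a) {c : ι → ℝ} {c₀ : ℝ} (hc : Tendsto c l (𝓝 c₀)) :
    MeanSqBdd l fun z i => c z * a z i := by
  obtain ⟨A, hA⟩ := ha
  refine ⟨(c₀ ^ 2 + 1) * |A|, ?_⟩
  filter_upwards [hA, (hc.pow 2).eventually_lt_const (lt_add_one (c₀ ^ 2))] with z h1 h2
  rw [meanSq_scalar_mul]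
  exact mul_le_mul h2.le (h1.trans (le_abs_self A)) (meanSq_nonneg a z) (by positivity)

lemma MeanSqBdd.sum {κ : Type*} (s : Finset κ) {f : κ → ∀ z, Fin (m z) → ℝ}
    (h : ∀ j ∈ s, MeanSqBdd l (f j)) : MeanSqBdd l fun z i => ∑ j ∈ s, f j z i := by
  classical
  induction s using Finset.induction_on with
  | empty => exact ⟨0, by simp⟩
  | insert j s hj ih =>
    simp only [Finset.sum_insert hj]
    exact (h j (Finset.mem_insert_self j s)).add
      (ih fun i hi => h i (Finset.mem_insert_of_mem hi))

lemma MeanSqBdd.scalar_null (ha : MeanSqBdd l a) {c : ι → ℝ} (hc : Tendsto c l (𝓝 0)) :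
    MeanSqNull l fun z i => c z * a z i := by
  obtain ⟨A, hA⟩ := ha
  refine .of_le (u := fun z => c z ^ 2 * |A|) ?_ (by simpa using (hc.pow 2).mul_const |A|)
  filter_upwards [hA] with z h1
  rw [meanSq_scalar_mul]
  gcongr
  exact h1.trans (le_abs_self A)

lemma MeanSqNull.scalar_mul (ha : MeanSqNull l a) {c : ι → ℝ} {c₀ : ℝ} (hc : Tendsto c l (𝓝 c₀)) :
    MeanSqNull l fun z i => c z * a z i := by
  have h := (hc.pow 2).mul ha
  rw [mul_zero] at h
  exact h.congr fun z => (meanSq_scalar_mul c a z).symm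

lemma SumSqNull.meanSqNull (ha : SumSqNull l a) : MeanSqNull l a := by
  refine .of_le (Eventually.of_forall fun z => ?_) ha
  exact mul_le_of_le_one_left (by positivity) (Nat.cast_inv_le_one _)

/-- A vanishing sum of squares controls the largest `b_i²`, so products are handled without any
higher moment of either factor. -/
lemma MeanSqBdd.mul_sumSqNull (ha : MeanSqBdd l a) (hb : SumSqNull l b) :
    MeanSqNull l fun z i => a z i * b z i := by
  obtain ⟨A, hA⟩ := ha
  refine .of_le (u := fun z => |A| * ∑ i, b z i ^ 2) ?_ (by simpa using Tendsto.const_mul |A| hb)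
  filter_upwards [hA] with z h1
  calc (m z : ℝ)⁻¹ * ∑ i, (a z i * b z i) ^ 2
      ≤ (m z : ℝ)⁻¹ * ∑ i, a z i ^ 2 * ∑ i', b z i' ^ 2 := by
        gcongr with i
        rw [mul_pow]
        gcongr
        exact Finset.single_le_sum (f := fun i => b z i ^ 2) (fun _ _ => sq_nonneg _)
          (Finset.mem_univ i)
    _ = ((m z : ℝ)⁻¹ * ∑ i, a z i ^ 2) * ∑ i', b z i' ^ 2 := by
        rw [← Finset.sum_mul, mul_assoc]
    _ ≤ _ := by
        gcongr
        exact h1.trans (le_abs_self A)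

lemma tendsto_zero_of_sq_le {u v : ι → ℝ} (h : ∀ᶠ z in l, u z ^ 2 ≤ v z)
    (hv : Tendsto v l (𝓝 0)) : Tendsto u l (𝓝 0) := by
  have h2 : Tendsto (fun z => u z ^ 2) l (𝓝 0) :=
    tendsto_of_tendsto_of_tendsto_of_le_of_le' tendsto_const_nhds hv
      (Eventually.of_forall fun z => sq_nonneg _) h
  have h3 := h2.sqrt
  simp only [Real.sqrt_sq_eq_abs, Real.sqrt_zero] at h3
  exact (tendsto_zero_iff_abs_tendsto_zero _).2 h3

lemma MeanSqBdd.mean_mul_null (ha : MeanSqBdd l a) (hb : MeanSqNull l b) :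
    Tendsto (fun z => (m z : ℝ)⁻¹ * ∑ i, a z i * b z i) l (𝓝 0) := by
  obtain ⟨A, hA⟩ := ha
  refine tendsto_zero_of_sq_le (v := fun z => |A| * ((m z : ℝ)⁻¹ * ∑ i, b z i ^ 2)) ?_
    (by simpa using Tendsto.const_mul |A| hb)
  filter_upwards [hA] with z h1
  calc ((m z : ℝ)⁻¹ * ∑ i, a z i * b z i) ^ 2
      = (m z : ℝ)⁻¹ ^ 2 * (∑ i, a z i * b z i) ^ 2 := by ring
    _ ≤ (m z : ℝ)⁻¹ ^ 2 * ((∑ i, a z i ^ 2) * ∑ i, b z i ^ 2) := by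
        gcongr
        exact Finset.sum_mul_sq_le_sq_mul_sq _ _ _
    _ = ((m z : ℝ)⁻¹ * ∑ i, a z i ^ 2) * ((m z : ℝ)⁻¹ * ∑ i, b z i ^ 2) := by ring
    _ ≤ _ := by
        gcongr
        exact h1.trans (le_abs_self A)

/-- After squaring, the normalization `1/m` is used up by the mean square of `a`, and the
unnormalized sum of `b_i²` remains. This is where the `n^(-1/2)` rate is needed, rather than mere
consistency. -/
lemma MeanSqBdd.sqrt_mean_mul_null (ha : MeanSqBdd l a) (hb : SumSqNull l b) :
    Tendsto (fun z => (√(m z : ℝ))⁻¹ * ∑ i, a z i * b z i) l (𝓝 0) := by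
  obtain ⟨A, hA⟩ := ha
  refine tendsto_zero_of_sq_le (v := fun z => |A| * ∑ i, b z i ^ 2) ?_
    (by simpa using Tendsto.const_mul |A| hb)
  filter_upwards [hA] with z h1
  calc ((√(m z : ℝ))⁻¹ * ∑ i, a z i * b z i) ^ 2
      = (m z : ℝ)⁻¹ * (∑ i, a z i * b z i) ^ 2 := by
        rw [mul_pow, inv_pow, Real.sq_sqrt (Nat.cast_nonneg _)]
    _ ≤ (m z : ℝ)⁻¹ * ((∑ i, a z i ^ 2) * ∑ i, b z i ^ 2) := by
        gcongr
        exact Finset.sum_mul_sq_le_sq_mul_sq _ _ _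
    _ = ((m z : ℝ)⁻¹ * ∑ i, a z i ^ 2) * ∑ i, b z i ^ 2 := by ring
    _ ≤ _ := by
        gcongr
        exact h1.trans (le_abs_self A)

/-- By Cramer's formula only the limiting determinant has to be nonzero; a singular `A z` has
inverse 0 by convention. -/
lemma Filter.Tendsto.matrix_inv {p : ℕ} {A : ι → Matrix (Fin p) (Fin p) ℝ}
    {G : Matrix (Fin p) (Fin p) ℝ} (h : Tendsto A l (𝓝 G)) (hG : IsUnit G) :
    Tendsto (fun z => (A z)⁻¹) l (𝓝 G⁻¹) := by
  have hdet : Tendsto (fun z => (A z).det) l (𝓝 G.det) :=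
    ((continuous_id.matrix_det).tendsto G).comp h
  have hadj : Tendsto (fun z => (A z).adjugate) l (𝓝 G.adjugate) :=
    ((continuous_id.matrix_adjugate).tendsto G).comp h
  have hne : G.det ≠ 0 := ((Matrix.isUnit_iff_isUnit_det G).1 hG).ne_zero
  simp only [Matrix.inv_def, Ring.inverse_eq_inv']
  exact (hdet.inv₀ hne).smul hadj

lemma Filter.Tendsto.matrix_mulVec {p : ℕ} {A : ι → Matrix (Fin p) (Fin p) ℝ}
    {M : Matrix (Fin p) (Fin p) ℝ} {v : ι → Fin p → ℝ} {w : Fin p → ℝ} (hA : Tendsto A l (𝓝 M))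
    (hv : Tendsto v l (𝓝 w)) : Tendsto (fun z => A z *ᵥ v z) l (𝓝 (M *ᵥ w)) := by
  refine tendsto_pi_nhds.2 fun j => ?_
  simp only [Matrix.mulVec, dotProduct]
  exact tendsto_finsetSum _ fun k _ =>
    ((tendsto_pi_nhds.1 ((tendsto_pi_nhds.1 hA) j)) k).mul ((tendsto_pi_nhds.1 hv) k)

end Arrays

/-! ## Least squares -/

/-- A quadratic polynomial minimized at the origin has no linear term. -/
lemma linear_coeff_eq_zero_of_quadratic_nonneg {B C : ℝ}
    (h : ∀ t : ℝ, 0 ≤ -(2 * t * B) + t ^ 2 * C) : B = 0 := by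
  by_contra hB
  have hC : 0 < |C| + 1 := by positivity
  -- Taking `t = B / (|C| + 1)` makes the polynomial at most `-B² / (|C| + 1)`; the summand 1 covers
  -- `C = 0`.
  have h1 := h (B / (|C| + 1))
  have h2 : -(2 * (B / (|C| + 1)) * B) + (B / (|C| + 1)) ^ 2 * C ≤
      -(2 * (B / (|C| + 1)) * B) + (B / (|C| + 1)) ^ 2 * (|C| + 1) := by
    gcongr
    linarith [le_abs_self C]
  have h3 : -(2 * (B / (|C| + 1)) * B) + (B / (|C| + 1)) ^ 2 * (|C| + 1) =
      -(B ^ 2 / (|C| + 1)) := by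
    field_simp
    ring
  have h4 : 0 < B ^ 2 / (|C| + 1) := by positivity
  linarith

/-- Normal equations of a least squares problem. -/
lemma sum_resid_mul_eq_zero {κ : Type*} [Fintype κ] {p : ℕ} (y : κ → ℝ) (x : κ → Fin p → ℝ)
    (b : Fin p → ℝ)
    (h : ∀ b' : Fin p → ℝ, ∑ i, (y i - ∑ j, b j * x i j) ^ 2 ≤ ∑ i, (y i - ∑ j, b' j * x i j) ^ 2)
    (j : Fin p) : ∑ i, (y i - ∑ l, b l * x i l) * x i j = 0 := by
  refine linear_coeff_eq_zero_of_quadratic_nonneg (C := ∑ i, x i j ^ 2) fun t => ?_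
  have h1 := h fun l => b l + if l = j then t else 0
  have h2 : ∀ i, ∑ l, (b l + if l = j then t else 0) * x i l = ∑ l, b l * x i l + t * x i j := by
    intro i
    simp [add_mul, Finset.sum_add_distrib]
  have h3 : ∑ i, (y i - ∑ l, (b l + if l = j then t else 0) * x i l) ^ 2 =
      ∑ i, (y i - ∑ l, b l * x i l) ^ 2 +
        (-(2 * t * ∑ i, (y i - ∑ l, b l * x i l) * x i j) + t ^ 2 * ∑ i, x i j ^ 2) := by
    simp only [h2, Finset.mul_sum, ← Finset.sum_neg_distrib, ← Finset.sum_add_distrib]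
    exact Finset.sum_congr rfl fun i _ => by ring
  linarith

/-! ## Asymptotic expansion of plug-in least squares -/

/-- Arrays describing a least squares regression on perturbed regressors `φ + δ`: the response is
`e + β₀ᵀ φ`, the coefficient `β` solves the normal equations, the empirical Gram matrix of `φ`
converges to an invertible matrix `G`, and the sums of squares of the perturbation vanish. -/
structure PerturbedLS {ι : Type*} (l : Filter ι) (n : ι → ℕ) {p : ℕ}
    (φ δ : Fin p → ∀ z, Fin (n z) → ℝ) (e : ∀ z, Fin (n z) → ℝ) (β₀ : Fin p → ℝ)
    (β : ι → Fin p → ℝ) (G : Matrix (Fin p) (Fin p) ℝ) : Prop where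
  size : Tendsto n l atTop
  gram : ∀ j k, Tendsto (fun z => (n z : ℝ)⁻¹ * ∑ i, φ j z i * φ k z i) l (𝓝 (G j k))
  isUnit_gram : IsUnit G
  resid : MeanSqBdd l e
  perturb : ∀ j, SumSqNull l (δ j)
  normal : ∀ z j, ∑ i, (e z i + ∑ k, β₀ k * φ k z i - ∑ k, β z k * (φ k z i + δ k z i)) *
    (φ j z i + δ j z i) = 0
  -- The score is bounded in probability, but in general not by one constant with probability
  -- tending to one. Along an abstract filter, its boundedness is recorded through its action on
  -- null sequences.
  score : ∀ j (Y : ι → ℝ), Tendsto Y l (𝓝 0) →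
    Tendsto (fun z => ((√(n z : ℝ))⁻¹ * ∑ i, e z i * φ j z i) * Y z) l (𝓝 0)

namespace PerturbedLS

variable {ι : Type*} {l : Filter ι} {n : ι → ℕ} {p : ℕ}
  {φ δ : Fin p → ∀ z, Fin (n z) → ℝ} {e : ∀ z, Fin (n z) → ℝ} {β₀ : Fin p → ℝ}
  {β : ι → Fin p → ℝ} {G : Matrix (Fin p) (Fin p) ℝ}

/-- The empirical Gram matrix of the perturbed regressors. -/
noncomputable def gram' (φ δ : Fin p → ∀ z, Fin (n z) → ℝ) (z : ι) : Matrix (Fin p) (Fin p) ℝ :=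
  Matrix.of fun j k => (n z : ℝ)⁻¹ * ∑ i, (φ j z i + δ j z i) * (φ k z i + δ k z i)

lemma gram'_transpose (φ δ : Fin p → ∀ z, Fin (n z) → ℝ) (z : ι) :
    (gram' φ δ z)ᵀ = gram' φ δ z := by
  ext j k
  simp only [gram', Matrix.transpose_apply, Matrix.of_apply, mul_comm]

/-- The scaled score. -/
noncomputable def scaledScore (φ : Fin p → ∀ z, Fin (n z) → ℝ) (e : ∀ z, Fin (n z) → ℝ) (z : ι)
    (j : Fin p) : ℝ :=
  (√(n z : ℝ))⁻¹ * ∑ i, e z i * φ j z i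

/-- The remainder in the linear expansion of the normal equations. -/
noncomputable def remainder (φ δ : Fin p → ∀ z, Fin (n z) → ℝ) (e : ∀ z, Fin (n z) → ℝ)
    (β₀ : Fin p → ℝ) (z : ι) (j : Fin p) : ℝ :=
  (√(n z : ℝ))⁻¹ * ∑ i, e z i * δ j z i -
    ∑ k, β₀ k * ((√(n z : ℝ))⁻¹ * ∑ i, (φ j z i + δ j z i) * δ k z i)

variable (h : PerturbedLS l n φ δ e β₀ β G)
include h

lemma meanSqBdd_regressor (j : Fin p) : MeanSqBdd l (φ j) :=
  .of_tendsto (c := G j j) (by simpa only [sq] using h.gram j j)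

lemma meanSqBdd_perturbed (j : Fin p) : MeanSqBdd l fun z i => φ j z i + δ j z i :=
  (h.meanSqBdd_regressor j).add (h.perturb j).meanSqNull.meanSqBdd

/-- In the expansion `φ_j φ_k + φ_j δ_k + (φ_k + δ_k) δ_j` the last two means vanish by
Cauchy–Schwarz. -/
lemma tendsto_gram' : Tendsto (gram' φ δ) l (𝓝 G) := by
  refine tendsto_pi_nhds.2 fun j => tendsto_pi_nhds.2 fun k => ?_
  have h1 := (h.gram j k).add (((h.meanSqBdd_regressor j).mean_mul_null
    (h.perturb k).meanSqNull).add ((h.meanSqBdd_perturbed k).mean_mul_null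
    (h.perturb j).meanSqNull))
  rw [add_zero, add_zero] at h1
  refine h1.congr fun z => ?_
  simp only [gram', Matrix.of_apply, ← mul_add, ← Finset.sum_add_distrib]
  congr 1
  exact Finset.sum_congr rfl fun i _ => by ring

lemma tendsto_remainder (j : Fin p) : Tendsto (fun z => remainder φ δ e β₀ z j) l (𝓝 0) := by
  have h1 : Tendsto (fun z => ∑ k, β₀ k *
      ((√(n z : ℝ))⁻¹ * ∑ i, (φ j z i + δ j z i) * δ k z i)) l (𝓝 (∑ k : Fin p, β₀ k * 0)) :=
    tendsto_finsetSum _ fun k _ =>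
      ((h.meanSqBdd_perturbed j).sqrt_mean_mul_null (h.perturb k)).const_mul _
  simpa [remainder] using (h.resid.sqrt_mean_mul_null (h.perturb j)).sub h1

/-- The fitted residual equals `e - (β - β₀)ᵀ(φ + δ) - β₀ᵀδ`. Its orthogonality to `φ_j + δ_j`,
scaled by `n^(-1/2)`, is this identity, which needs no invertibility. -/
lemma gram'_mulVec (z : ι) :
    gram' φ δ z *ᵥ (fun k => √(n z : ℝ) * (β z k - β₀ k)) =
      fun j => scaledScore φ e z j + remainder φ δ e β₀ z j := by
  ext j
  have hsq : (n z : ℝ)⁻¹ * √(n z : ℝ) = (√(n z : ℝ))⁻¹ := by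
    rw [← div_eq_inv_mul, Real.sqrt_div_self]
  have hn := h.normal z j
  have h1 : (gram' φ δ z *ᵥ fun k => √(n z : ℝ) * (β z k - β₀ k)) j =
      (√(n z : ℝ))⁻¹ * ∑ i, (∑ k, (β z k - β₀ k) * (φ k z i + δ k z i)) * (φ j z i + δ j z i) := by
    simp only [Matrix.mulVec, dotProduct, gram', Matrix.of_apply, ← hsq, Finset.mul_sum,
      Finset.sum_mul]
    rw [Finset.sum_comm]
    exact Finset.sum_congr rfl fun i _ => Finset.sum_congr rfl fun k _ => by ring
  have h2 : ∑ k, β₀ k * ((√(n z : ℝ))⁻¹ * ∑ i, (φ j z i + δ j z i) * δ k z i) =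
      (√(n z : ℝ))⁻¹ * ∑ i, (∑ k, β₀ k * δ k z i) * (φ j z i + δ j z i) := by
    simp only [Finset.mul_sum, Finset.sum_mul]
    rw [Finset.sum_comm]
    exact Finset.sum_congr rfl fun i _ => Finset.sum_congr rfl fun k _ => by ring
  rw [h1, scaledScore, remainder, h2, ← mul_sub, ← mul_add, ← Finset.sum_sub_distrib,
    ← Finset.sum_add_distrib]
  congr 1
  rw [← sub_eq_zero, ← neg_eq_zero, ← Finset.sum_sub_distrib, ← Finset.sum_neg_distrib, ← hn]
  refine Finset.sum_congr rfl fun i _ => ?_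
  simp only [sub_mul, mul_add, Finset.sum_sub_distrib, Finset.sum_add_distrib]
  ring

lemma eventually_sqrt_mul_sub_eq : ∀ᶠ z in l, (fun k => √(n z : ℝ) * (β z k - β₀ k)) =
    (gram' φ δ z)⁻¹ *ᵥ fun j => scaledScore φ e z j + remainder φ δ e β₀ z j := by
  have hdet : Tendsto (fun z => (gram' φ δ z).det) l (𝓝 G.det) :=
    ((continuous_id.matrix_det).tendsto G).comp h.tendsto_gram'
  have hne : G.det ≠ 0 := ((Matrix.isUnit_iff_isUnit_det G).1 h.isUnit_gram).ne_zero
  filter_upwards [hdet.eventually_ne hne] with z hz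
  rw [← h.gram'_mulVec z, Matrix.mulVec_mulVec, Matrix.nonsing_inv_mul _ (isUnit_iff_ne_zero.2 hz),
    Matrix.one_mulVec]

lemma tendsto_scaledScore_dotProduct {w : ι → Fin p → ℝ} (hw : Tendsto w l (𝓝 0)) :
    Tendsto (fun z => scaledScore φ e z ⬝ᵥ w z) l (𝓝 0) := by
  have : Tendsto (fun z => ∑ j, scaledScore φ e z j * w z j) l (𝓝 (∑ _ : Fin p, 0)) :=
    tendsto_finsetSum _ fun j _ => h.score j _ ((tendsto_pi_nhds.1 hw) j)
  simpa only [Finset.sum_const_zero, dotProduct] using this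

lemma tendsto_inv_sqrt_size : Tendsto (fun z => (√(n z : ℝ))⁻¹) l (𝓝 0) :=
  (Real.tendsto_sqrt_atTop.comp (tendsto_natCast_atTop_atTop.comp h.size)).inv_tendsto_atTop

/-- Consistency of the least squares coefficient. -/
lemma tendsto_coeff : Tendsto β l (𝓝 β₀) := by
  have h0 := h.tendsto_inv_sqrt_size
  have hv : Tendsto (fun z => fun j => (√(n z : ℝ))⁻¹ *
      (scaledScore φ e z j + remainder φ δ e β₀ z j)) l (𝓝 0) := by
    refine tendsto_pi_nhds.2 fun j => ?_
    have h1 := (h.score j _ h0).add (h0.mul (h.tendsto_remainder j))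
    rw [mul_zero, add_zero] at h1
    exact h1.congr fun z => by rw [scaledScore]; ring
  have hm : Tendsto (fun z => (gram' φ δ z)⁻¹ *ᵥ fun j => (√(n z : ℝ))⁻¹ *
      (scaledScore φ e z j + remainder φ δ e β₀ z j)) l (𝓝 (G⁻¹ *ᵥ 0)) :=
    (h.tendsto_gram'.matrix_inv h.isUnit_gram).matrix_mulVec hv
  rw [Matrix.mulVec_zero] at hm
  have hs : Tendsto (fun z => β z - β₀) l (𝓝 0) := by
    refine hm.congr' ?_
    filter_upwards [h.eventually_sqrt_mul_sub_eq, h.size.eventually_gt_atTop 0] with z hz hnz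
    have hpos : 0 < √(n z : ℝ) := Real.sqrt_pos.2 (Nat.cast_pos.2 hnz)
    have : (fun j => (√(n z : ℝ))⁻¹ * (scaledScore φ e z j + remainder φ δ e β₀ z j)) =
        (√(n z : ℝ))⁻¹ • fun j => scaledScore φ e z j + remainder φ δ e β₀ z j := rfl
    rw [this, Matrix.mulVec_smul, ← hz]
    ext j
    simp [hpos.ne']
  simpa using hs.add_const β₀

/-- The plug-in weight vector `Ĝ⁻¹ b̂` is consistent. -/
lemma tendsto_gram'_inv_mulVec {b : Fin p → ℝ} {bh : ι → Fin p → ℝ} (hb : Tendsto bh l (𝓝 b)) :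
    Tendsto (fun z => (gram' φ δ z)⁻¹ *ᵥ bh z) l (𝓝 (G⁻¹ *ᵥ b)) :=
  (h.tendsto_gram'.matrix_inv h.isUnit_gram).matrix_mulVec hb

/-- Consistency of a weight estimated at a rate faster than `n^(-1/2)`. -/
lemma tendsto_of_sqrt_rate {b : Fin p → ℝ} {bh : ι → Fin p → ℝ}
    (hb : ∀ j, Tendsto (fun z => √(n z : ℝ) * (bh z j - b j)) l (𝓝 0)) : Tendsto bh l (𝓝 b) := by
  refine tendsto_pi_nhds.2 fun j => ?_
  have h1 := h.tendsto_inv_sqrt_size.mul (hb j)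
  rw [mul_zero] at h1
  have h2 : Tendsto (fun z => bh z j - b j) l (𝓝 0) := by
    refine h1.congr' ?_
    filter_upwards [h.size.eventually_gt_atTop 0] with z hnz
    have hpos : 0 < √(n z : ℝ) := Real.sqrt_pos.2 (Nat.cast_pos.2 hnz)
    rw [inv_mul_cancel_left₀ hpos.ne']
  simpa using h2.add_const (b j)

/-- **Asymptotic linearity** of the plug-in functional `βᵀ b̂`. -/
lemma tendsto_sqrt_mul_sub_scaledScore {b : Fin p → ℝ} {bh : ι → Fin p → ℝ}
    (hb : ∀ j, Tendsto (fun z => √(n z : ℝ) * (bh z j - b j)) l (𝓝 0)) :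
    Tendsto (fun z => √(n z : ℝ) * (β z ⬝ᵥ bh z - β₀ ⬝ᵥ b) - scaledScore φ e z ⬝ᵥ (G⁻¹ *ᵥ b)) l
      (𝓝 0) := by
  have hbh := h.tendsto_of_sqrt_rate hb
  have ha := h.tendsto_gram'_inv_mulVec hbh
  -- The difference splits into three null terms: the error of `bh` against `β₀`, the score against
  -- the error of the plug-in weight `Ĝ⁻¹ bh`, and the remainder against that weight.
  have h1 : Tendsto (fun z => ∑ j, β₀ j * (√(n z : ℝ) * (bh z j - b j))) l
      (𝓝 (∑ j : Fin p, β₀ j * 0)) := tendsto_finsetSum _ fun j _ => (hb j).const_mul _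
  have h2 : Tendsto (fun z => scaledScore φ e z ⬝ᵥ ((gram' φ δ z)⁻¹ *ᵥ bh z - G⁻¹ *ᵥ b)) l
      (𝓝 0) := h.tendsto_scaledScore_dotProduct (by simpa using ha.sub_const (G⁻¹ *ᵥ b))
  have h3 : Tendsto (fun z => ∑ j, remainder φ δ e β₀ z j * ((gram' φ δ z)⁻¹ *ᵥ bh z) j) l
      (𝓝 (∑ j : Fin p, 0 * (G⁻¹ *ᵥ b) j)) :=
    tendsto_finsetSum _ fun j _ => (h.tendsto_remainder j).mul ((tendsto_pi_nhds.1 ha) j)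
  have h4 := (h1.add h2).add h3
  simp only [mul_zero, zero_mul, Finset.sum_const_zero, add_zero] at h4
  refine h4.congr' ?_
  filter_upwards [h.eventually_sqrt_mul_sub_eq] with z hz
  have hsplit : √(n z : ℝ) * (β z ⬝ᵥ bh z - β₀ ⬝ᵥ b) =
      ∑ j, β₀ j * (√(n z : ℝ) * (bh z j - b j)) +
        (fun k => √(n z : ℝ) * (β z k - β₀ k)) ⬝ᵥ bh z := by
    simp only [dotProduct, ← Finset.sum_sub_distrib, Finset.mul_sum, ← Finset.sum_add_distrib]
    exact Finset.sum_congr rfl fun j _ => by ring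
  -- Symmetry of the Gram matrix moves its inverse from the score onto `bh`.
  have hsym : ∀ v, ((gram' φ δ z)⁻¹ *ᵥ v) ⬝ᵥ bh z = v ⬝ᵥ ((gram' φ δ z)⁻¹ *ᵥ bh z) := by
    intro v
    rw [dotProduct_comm, Matrix.dotProduct_mulVec, ← Matrix.mulVec_transpose,
      Matrix.transpose_nonsing_inv, gram'_transpose, dotProduct_comm]
  have hadd : (fun j => scaledScore φ e z j + remainder φ δ e β₀ z j) =
      scaledScore φ e z + remainder φ δ e β₀ z := rfl
  rw [hsplit, hz, hsym, hadd, add_dotProduct, dotProduct_sub]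
  simp only [dotProduct]
  ring

/-- Consistency of the estimated score covariance. -/
lemma tendsto_meat {M : Matrix (Fin p) (Fin p) ℝ}
    (hM : ∀ j k, Tendsto (fun z => (n z : ℝ)⁻¹ *
      ∑ i, (e z i * φ j z i) * (e z i * φ k z i)) l (𝓝 (M j k)))
    (h4 : ∀ j k, MeanSqBdd l fun z i => φ j z i * φ k z i) (j k : Fin p) :
    Tendsto (fun z => (n z : ℝ)⁻¹ * ∑ i,
      ((e z i + ∑ k, β₀ k * φ k z i - ∑ k, β z k * (φ k z i + δ k z i)) * (φ j z i + δ j z i)) *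
      ((e z i + ∑ k, β₀ k * φ k z i - ∑ k, β z k * (φ k z i + δ k z i)) * (φ k z i + δ k z i)))
      l (𝓝 (M j k)) := by
  set u : Fin p → ∀ z, Fin (n z) → ℝ := fun j z i =>
    (e z i + ∑ k, β₀ k * φ k z i - ∑ k, β z k * (φ k z i + δ k z i)) * (φ j z i + δ j z i) -
      e z i * φ j z i with hu
  have hγ : ∀ k, Tendsto (fun z => β z k - β₀ k) l (𝓝 0) := fun k => by
    simpa using ((tendsto_pi_nhds.1 h.tendsto_coeff) k).sub_const (β₀ k)
  have hβ : ∀ k, Tendsto (fun z => β z k) l (𝓝 (β₀ k)) := tendsto_pi_nhds.1 h.tendsto_coeff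
  have hun : ∀ j, MeanSqNull l (u j) := by
    intro j
    -- The fitted residual is `e - (β - β₀)ᵀφ - βᵀδ`. Fourth moments of `φ` enter only through `t2`,
    -- where the coefficient error vanishes; every other product contains a `δ`, whose sum of
    -- squares vanishes.
    have t1 : MeanSqNull l fun z i => e z i * δ j z i := h.resid.mul_sumSqNull (h.perturb j)
    have t2 : MeanSqNull l fun z i => ∑ k, (β z k - β₀ k) * (φ k z i * φ j z i) :=
      .sum _ fun k _ => (h4 k j).scalar_null (hγ k)
    have t3 : MeanSqNull l fun z i => ∑ k, (β z k - β₀ k) * (φ k z i * δ j z i) :=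
      .sum _ fun k _ => ((h.meanSqBdd_regressor k).mul_sumSqNull (h.perturb j)).scalar_mul (hγ k)
    have t4 : MeanSqNull l fun z i => ∑ k, β z k * ((φ j z i + δ j z i) * δ k z i) :=
      .sum _ fun k _ => ((h.meanSqBdd_perturbed j).mul_sumSqNull (h.perturb k)).scalar_mul (hβ k)
    have t5 := ((t1.sub t2).sub t3).sub t4
    convert t5 using 3 with z i
    simp only [hu, sub_mul, add_mul, mul_add, Finset.sum_sub_distrib, Finset.sum_add_distrib,
      Finset.sum_mul, mul_assoc]
    simp only [mul_comm (δ j z i), mul_comm (φ j z i)]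
    ring
  have hr : ∀ j, MeanSqBdd l fun z i => e z i * φ j z i := fun j =>
    .of_tendsto (c := M j j) (by simpa only [sq] using hM j j)
  have h5 := (hM j k).add (((hr j).mean_mul_null (hun k)).add
    (((hr k).add (hun k).meanSqBdd).mean_mul_null (hun j)))
  rw [add_zero, add_zero] at h5
  refine h5.congr fun z => ?_
  rw [← mul_add, ← mul_add, ← Finset.sum_add_distrib, ← Finset.sum_add_distrib]
  congr 1
  refine Finset.sum_congr rfl fun i _ => ?_
  simp only [hu]
  ring

end PerturbedLS

/-! ## Conditional Markov inequalities -/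

section Conditional

variable {Ω A B : Type*} [MeasurableSpace Ω] [MeasurableSpace A] [MeasurableSpace B]
  {P : Measure Ω} [IsProbabilityMeasure P]

/-- Integrating out an independent variable. -/
lemma setLIntegral_indepFun {U : Ω → A} {V : Ω → B} (hU : Measurable U) (hV : Measurable V)
    (hUV : IndepFun U V P) {q : A × B → ℝ≥0∞} (hq : Measurable q) {E : Set A}
    (hE : MeasurableSet E) :
    ∫⁻ ω in U ⁻¹' E, q (U ω, V ω) ∂P =
      ∫⁻ ω in U ⁻¹' E, ∫⁻ y, q (U ω, y) ∂(P.map V) ∂P := by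
  have : IsProbabilityMeasure (P.map V) := Measure.isProbabilityMeasure_map hV.aemeasurable
  have : IsProbabilityMeasure (P.map U) := Measure.isProbabilityMeasure_map hU.aemeasurable
  have hE' : MeasurableSet (E ×ˢ (Set.univ : Set B)) := hE.prod MeasurableSet.univ
  have h1 : ∫⁻ ω in U ⁻¹' E, q (U ω, V ω) ∂P =
      ∫⁻ z in E ×ˢ Set.univ, q z ∂((P.map U).prod (P.map V)) := by
    rw [← (indepFun_iff_map_prod_eq_prod_map_map hU.aemeasurable hV.aemeasurable).1 hUV,
      setLIntegral_map hE' hq (hU.prodMk hV)]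
    congr 2
    ext ω
    simp
  rw [h1, ← Measure.prod_restrict, Measure.restrict_univ, lintegral_prod _ hq.aemeasurable,
    setLIntegral_map hE hq.lintegral_prod_right' hU]

/-- The bound `c` holds conditionally on each value of `U` in `E`, and the event has mass at most
one. In the applications `U` is what the learner uses and `V` is a fresh unit. -/
lemma setLIntegral_le_of_indepFun {U : Ω → A} {V : Ω → B} (hU : Measurable U) (hV : Measurable V)
    (hUV : IndepFun U V P) {q : A × B → ℝ≥0∞} (hq : Measurable q) {E : Set A}
    (hE : MeasurableSet E) {c : ℝ≥0∞} (hc : ∀ u ∈ E, ∫⁻ y, q (u, y) ∂(P.map V) ≤ c) :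
    ∫⁻ ω in U ⁻¹' E, q (U ω, V ω) ∂P ≤ c := by
  rw [setLIntegral_indepFun hU hV hUV hq hE]
  refine (setLIntegral_mono' (g := fun _ => c) (hU hE) fun ω hω => hc _ hω).trans ?_
  rw [setLIntegral_const]
  exact mul_le_of_le_one_right zero_le prob_le_one

/-- The hypotheses make the three variables jointly independent, so their joint law is a product and
its factors may be permuted. It serves to separate one observational unit from the other units
together with the folds and the seed. -/
lemma ProbabilityTheory.IndepFun.prodMk_right_comm {C : Type*} [MeasurableSpace C] {U : Ω → A}
    {V : Ω → B} {W : Ω → C} (hU : Measurable U) (hV : Measurable V) (hW : Measurable W)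
    (hUV : IndepFun U V P) (hUVW : IndepFun (fun ω => (U ω, V ω)) W P) :
    IndepFun (fun ω => (U ω, W ω)) V P := by
  have : IsProbabilityMeasure (P.map U) := Measure.isProbabilityMeasure_map hU.aemeasurable
  have : IsProbabilityMeasure (P.map V) := Measure.isProbabilityMeasure_map hV.aemeasurable
  have : IsProbabilityMeasure (P.map W) := Measure.isProbabilityMeasure_map hW.aemeasurable
  have hUW : IndepFun U W P := hUVW.comp measurable_fst measurable_id
  rw [indepFun_iff_map_prod_eq_prod_map_map (hU.prodMk hW).aemeasurable hV.aemeasurable,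
    (indepFun_iff_map_prod_eq_prod_map_map hU.aemeasurable hW.aemeasurable).1 hUW]
  have h1 := (indepFun_iff_map_prod_eq_prod_map_map (hU.prodMk hV).aemeasurable
    hW.aemeasurable).1 hUVW
  rw [(indepFun_iff_map_prod_eq_prod_map_map hU.aemeasurable hV.aemeasurable).1 hUV] at h1
  have e1 := measurePreserving_prodAssoc (P.map U) (P.map V) (P.map W)
  have e2 := (MeasurePreserving.id (P.map U)).prod
    (Measure.measurePreserving_swap (μ := P.map V) (ν := P.map W))
  have e3 := (measurePreserving_prodAssoc (P.map U) (P.map W) (P.map V)).symm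
  have e := e3.comp (e2.comp e1)
  rw [← e.map_eq, ← h1, Measure.map_map e.measurable ((hU.prodMk hV).prodMk hW)]
  rfl

lemma eLpNorm_two_sq_eq_lintegral {E : Type*} [MeasurableSpace E] {ν : Measure E} (f : E → ℝ) :
    eLpNorm f 2 ν ^ 2 = ∫⁻ x, ‖f x‖ₑ ^ 2 ∂ν := by
  have := eLpNorm_nnreal_pow_eq_lintegral (f := f) (p := 2) (μ := ν) two_ne_zero
  simpa using this

omit [IsProbabilityMeasure P] in
/-- A nonnegative sequence `Q` whose expectation on `{T ≤ c}` is at most `m c`, where `T` is bounded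
by the square of an `o_p(n^(-1/2))` sequence, satisfies `(n / m) Q = o_p(1)`. -/
lemma tendsto_of_setLIntegral_le {n m : ℕ → ℕ} (hn : Tendsto n atTop atTop)
    (hm : Tendsto m atTop atTop) {Q : ℕ → Ω → ℝ} (hQ : ∀ t ω, 0 ≤ Q t ω)
    (hQm : ∀ t, Measurable (Q t)) {T R : ℕ → Ω → ℝ≥0∞} (hT : ∀ t, Measurable (T t))
    (hTR : ∀ t ω, T t ω ≤ R t ω ^ 2) (hR : IsLittleOp P R fun t => (√(n t : ℝ))⁻¹)
    (hint : ∀ t (c : ℝ≥0∞), ∫⁻ ω in {ω | T t ω ≤ c}, ENNReal.ofReal (Q t ω) ∂P ≤ m t * c) :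
    Tendsto (fun z : ℕ × Ω => (n z.1 : ℝ) / (m z.1 : ℝ) * Q z.1 z.2) (probFilter P) (𝓝 0) := by
  rw [Metric.tendsto_nhds]
  intro ε hε
  refine eventually_probFilter_of_forall_le_add fun η hη => ?_
  have ha : 0 < ε * η := by positivity
  refine ⟨_, hR (√(ε * η)) (Real.sqrt_pos.2 ha), ?_⟩
  filter_upwards [hn.eventually_gt_atTop 0, hm.eventually_gt_atTop 0] with t hnt hmt
  have hn' : (0 : ℝ) < n t := Nat.cast_pos.2 hnt
  have hm' : (0 : ℝ) < m t := Nat.cast_pos.2 hmt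
  -- Here `c` is the square of the threshold `√(εη) n^(-1/2)` at which the rate is applied, and `d =
  -- ε m / n` is the level of `Q` corresponding to `ε`. Markov's inequality then gives exactly `m c
  -- / d = η`.
  set c : ℝ := ε * η / n t with hc
  have hc0 : 0 < c := by positivity
  set E : Set Ω := {ω | T t ω ≤ ENNReal.ofReal c} with hE
  have hEm : MeasurableSet E := measurableSet_le (hT t) measurable_const
  set d : ℝ := ε * m t / n t with hd
  have hd0 : 0 < d := by positivity
  have hmarkov : P ({ω | ENNReal.ofReal d ≤ ENNReal.ofReal (Q t ω)} ∩ E) ≤ ENNReal.ofReal η := by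
    rw [← Measure.restrict_apply (measurableSet_le measurable_const (hQm t).ennreal_ofReal)]
    refine (meas_ge_le_lintegral_div (hQm t).ennreal_ofReal.aemeasurable
      (ENNReal.ofReal_pos.2 hd0).ne' ENNReal.ofReal_ne_top).trans ?_
    refine (ENNReal.div_le_div_right (hint t _) _).trans ?_
    rw [← ENNReal.ofReal_natCast, ← ENNReal.ofReal_mul hm'.le, ← ENNReal.ofReal_div_of_pos hd0]
    refine ENNReal.ofReal_le_ofReal (le_of_eq ?_)
    rw [hc, hd]
    field_simp
  refine (measure_mono fun ω hω => ?_).trans ((measure_union_le _ _).trans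
    (add_le_add_right hmarkov _))
  simp only [Set.mem_ofPred_eq, dist_zero_right, Real.norm_eq_abs, not_lt] at hω
  rw [abs_of_nonneg (mul_nonneg (by positivity) (hQ t ω))] at hω
  by_cases hωE : ω ∈ E
  · refine Or.inr ⟨ENNReal.ofReal_le_ofReal ?_, hωE⟩
    rw [hd, div_le_iff₀ hn']
    rw [div_mul_eq_mul_div, le_div_iff₀ hm'] at hω
    linarith
  · refine Or.inl ?_
    simp only [hE, Set.mem_ofPred_eq, not_le] at hωE
    have h1 := hωE.trans_le (hTR t ω)
    have h2 : ENNReal.ofReal c = ENNReal.ofReal (√(ε * η) * (√(n t : ℝ))⁻¹) ^ 2 := by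
      rw [← ENNReal.ofReal_pow (by positivity), mul_pow, inv_pow, Real.sq_sqrt ha.le,
        Real.sq_sqrt hn'.le, hc, div_eq_mul_inv]
    rw [h2] at h1
    exact (ENNReal.pow_right_strictMono two_ne_zero).lt_iff_lt.1 h1

end Conditional

/-! ## Perturbations caused by the cross-fit estimates -/

namespace CrossFitSample

variable {Ω 𝓧 𝓤 : Type*} [MeasurableSpace Ω] [MeasurableSpace 𝓧] [MeasurableSpace 𝓤]
  {P : Measure Ω} {Prct : Measure (ℝ × 𝓧)} {Pobs : Measure (𝓧 × Bool × ℝ)} {n N K : ℕ}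
  (s : CrossFitSample 𝓤 P Prct Pobs n N K)

/-- The cross-fit contrast as a function of the observational sample, the folds and the seed. -/
def contrastOf (k : Fin K) (u : (Fin N → 𝓧 × Bool × ℝ) × (Fin N → Fin K) × 𝓤) : 𝓧 → ℝ :=
  s.learner k u.2.2 (Finset.univ.filter fun i => u.2.1 i = k)ᶜ fun i => u.1 i

/-- The observational sample, the folds and the seed. -/
def source (ω : Ω) : (Fin N → 𝓧 × Bool × ℝ) × (Fin N → Fin K) × 𝓤 :=
  (fun i => s.obs i ω, s.fold ω, s.seed ω)

lemma measurable_source : Measurable s.source :=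
  (measurable_pi_lambda _ s.measurable_obs).prodMk (s.measurable_fold.prodMk s.measurable_seed)

lemma contrastCF_eq (k : Fin K) (ω : Ω) : s.contrastCF k ω = s.contrastOf k (s.source ω) := rfl

/-- The type of the training sample varies with the random folds, so the learner is measurable for
each fixed assignment only; the countably many assignments are glued together. -/
lemma measurable_contrastOf (k : Fin K) :
    Measurable fun q : ((Fin N → 𝓧 × Bool × ℝ) × (Fin N → Fin K) × 𝓤) × 𝓧 =>
      s.contrastOf k q.1 q.2 := by
  have h : Measurable fun q : (Fin N → Fin K) × ((Fin N → 𝓧 × Bool × ℝ) × 𝓤 × 𝓧) =>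
      s.contrastOf k (q.2.1, q.1, q.2.2.1) q.2.2.2 := by
    refine measurable_from_prod_countable_right fun f => ?_
    exact (s.measurable_learner k (Finset.univ.filter fun i => f i = k)ᶜ).comp
      (f := fun q : (Fin N → 𝓧 × Bool × ℝ) × 𝓤 × 𝓧 =>
        (q.2.1, (fun i : ((Finset.univ.filter fun i => f i = k)ᶜ : Finset (Fin N)) => q.1 i),
          q.2.2))
      (by fun_prop)
  exact h.comp (f := fun q : ((Fin N → 𝓧 × Bool × ℝ) × (Fin N → Fin K) × 𝓤) × 𝓧 =>
    (q.1.2.1, q.1.1, q.1.2.2, q.2)) (by fun_prop)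

/-- The averaged contrast as a function of the observational sample, the folds and the seed. -/
noncomputable def avgOf (u : (Fin N → 𝓧 × Bool × ℝ) × (Fin N → Fin K) × 𝓤) (x : 𝓧) : ℝ :=
  (K : ℝ)⁻¹ * ∑ k, s.contrastOf k u x

lemma contrastAvg_eq (ω : Ω) : s.contrastAvg ω = s.avgOf (s.source ω) := rfl

lemma measurable_avgOf :
    Measurable fun q : ((Fin N → 𝓧 × Bool × ℝ) × (Fin N → Fin K) × 𝓤) × 𝓧 =>
      s.avgOf q.1 q.2 :=
  (Finset.measurable_sum _ fun k _ => s.measurable_contrastOf k).const_mul _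

lemma measurable_contrastCF_comp (k : Fin K) {X : Ω → 𝓧} (hX : Measurable X) :
    Measurable fun ω => s.contrastCF k ω (X ω) :=
  (s.measurable_contrastOf k).comp (s.measurable_source.prodMk hX)

lemma measurable_contrastAvg_comp {X : Ω → 𝓧} (hX : Measurable X) :
    Measurable fun ω => s.contrastAvg ω (X ω) :=
  s.measurable_avgOf.comp (s.measurable_source.prodMk hX)

/-- An observational unit is independent of the other units, the folds and the seed. -/
lemma indepFun_obs_rest [IsProbabilityMeasure P] (i : Fin N) :
    IndepFun (fun ω => ((fun j : (Finset.univ.erase i : Finset (Fin N)) => s.obs j ω),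
      (s.fold ω, s.seed ω))) (s.obs i) P := by
  have hU : Measurable fun ω => fun j : (Finset.univ.erase i : Finset (Fin N)) => s.obs j ω :=
    measurable_pi_lambda _ fun j => s.measurable_obs j
  refine IndepFun.prodMk_right_comm hU (s.measurable_obs i)
    (s.measurable_fold.prodMk s.measurable_seed) ?_ ?_
  · have h := s.indep_obs.indepFun_finset (Finset.univ.erase i) {i} (by simp) s.measurable_obs
    exact h.comp (φ := id) (ψ := fun w : ({i} : Finset (Fin N)) → 𝓧 × Bool × ℝ =>
      w ⟨i, Finset.mem_singleton_self i⟩) measurable_id (measurable_pi_apply _)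
  · exact s.indep_obs_aux.comp (φ := fun w : Fin N → 𝓧 × Bool × ℝ =>
      ((fun j : (Finset.univ.erase i : Finset (Fin N)) => w j), w i)) (ψ := id)
      (by fun_prop) measurable_id

lemma measurable_lintegral_avg [IsProbabilityMeasure Prct] {g : 𝓧 × ℝ → ℝ} (hg : Measurable g) :
    Measurable fun ω => eLpNorm (fun x => g (x, s.contrastAvg ω x)) 2 (Prct.map Prod.snd) ^ 2 := by
  have : IsProbabilityMeasure (Prct.map Prod.snd) :=
    Measure.isProbabilityMeasure_map measurable_snd.aemeasurable
  simp only [eLpNorm_two_sq_eq_lintegral, contrastAvg_eq]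
  exact ((hg.comp (measurable_snd.prodMk s.measurable_avgOf)).enorm.pow_const
    2).lintegral_prod_right'.comp s.measurable_source

lemma measurable_lintegral_contrastOf [IsProbabilityMeasure Pobs] (k : Fin K) {g : 𝓧 × ℝ → ℝ}
    (hg : Measurable g) :
    Measurable fun u => ∫⁻ x, ‖g (x, s.contrastOf k u x)‖ₑ ^ 2 ∂(Pobs.map Prod.fst) := by
  have : IsProbabilityMeasure (Pobs.map Prod.fst) :=
    Measure.isProbabilityMeasure_map measurable_fst.aemeasurable
  exact ((hg.comp (measurable_snd.prodMk (s.measurable_contrastOf k))).enorm.pow_const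
    2).lintegral_prod_right'

lemma measurable_lintegral_cf [IsProbabilityMeasure Pobs] (k : Fin K) {g : 𝓧 × ℝ → ℝ}
    (hg : Measurable g) :
    Measurable fun ω => eLpNorm (fun x => g (x, s.contrastCF k ω x)) 2 (Pobs.map Prod.fst) ^ 2 := by
  simp only [eLpNorm_two_sq_eq_lintegral, contrastCF_eq]
  exact (s.measurable_lintegral_contrastOf k hg).comp s.measurable_source

/-! ### Conditional second moments of the regressor errors. -/

/-- Expected sum of squared errors over the experimental sample. -/
lemma setLIntegral_rct_le [IsProbabilityMeasure P] [IsProbabilityMeasure Prct] {g : 𝓧 × ℝ → ℝ}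
    (hg : Measurable g) (c : ℝ≥0∞) :
    ∫⁻ ω in {ω | eLpNorm (fun x => g (x, s.contrastAvg ω x)) 2 (Prct.map Prod.snd) ^ 2 ≤ c},
      ENNReal.ofReal (∑ i, g ((s.rct i ω).2, s.contrastAvg ω (s.rct i ω).2) ^ 2) ∂P ≤ n * c := by
  have : IsProbabilityMeasure (Prct.map Prod.snd) :=
    Measure.isProbabilityMeasure_map measurable_snd.aemeasurable
  set E : Set ((Fin N → 𝓧 × Bool × ℝ) × (Fin N → Fin K) × 𝓤) :=
    {u | ∫⁻ x, ‖g (x, s.avgOf u x)‖ₑ ^ 2 ∂(Prct.map Prod.snd) ≤ c} with hEdef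
  have hq : Measurable fun q : ((Fin N → 𝓧 × Bool × ℝ) × (Fin N → Fin K) × 𝓤) × (ℝ × 𝓧) =>
      ‖g (q.2.2, s.avgOf q.1 q.2.2)‖ₑ ^ 2 :=
    (hg.comp (measurable_snd.snd.prodMk (s.measurable_avgOf.comp
      (measurable_fst.prodMk measurable_snd.snd)))).enorm.pow_const 2
  have hqx : ∀ u, Measurable fun x => ‖g (x, s.avgOf u x)‖ₑ ^ 2 := fun u =>
    (hg.comp (measurable_id.prodMk (s.measurable_avgOf.comp
      (measurable_const.prodMk measurable_id)))).enorm.pow_const 2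
  have hE : MeasurableSet E := measurableSet_le ((hg.comp (measurable_snd.prodMk
    s.measurable_avgOf)).enorm.pow_const 2).lintegral_prod_right' measurable_const
  have hset : {ω | eLpNorm (fun x => g (x, s.contrastAvg ω x)) 2 (Prct.map Prod.snd) ^ 2 ≤ c} =
      s.source ⁻¹' E := by
    ext ω
    simp only [eLpNorm_two_sq_eq_lintegral, contrastAvg_eq, hEdef, Set.mem_ofPred_eq,
      Set.mem_preimage]
  have hint : ∀ ω, ENNReal.ofReal (∑ i, g ((s.rct i ω).2, s.contrastAvg ω (s.rct i ω).2) ^ 2) =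
      ∑ i, ‖g ((s.rct i ω).2, s.avgOf (s.source ω) (s.rct i ω).2)‖ₑ ^ 2 := by
    intro ω
    rw [ENNReal.ofReal_sum_of_nonneg fun _ _ => sq_nonneg _]
    refine Finset.sum_congr rfl fun i _ => ?_
    rw [← sq_abs, ENNReal.ofReal_pow (abs_nonneg _), Real.enorm_eq_ofReal_abs, contrastAvg_eq]
  simp only [hint]
  have hqi : ∀ i, Measurable fun ω =>
      ‖g ((s.rct i ω).2, s.avgOf (s.source ω) (s.rct i ω).2)‖ₑ ^ 2 := fun i =>
    hq.comp (s.measurable_source.prodMk (s.measurable_rct i))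
  rw [hset, lintegral_finsetSum _ fun i _ => hqi i]
  calc _ ≤ ∑ _ : Fin n, c := Finset.sum_le_sum fun i _ => ?_
    _ = n * c := by simp
  -- The averaged contrast depends on the observational data, folds and seed alone, hence is
  -- independent of the experimental unit; given these, the unit contributes the squared L² error.
  refine setLIntegral_le_of_indepFun s.measurable_source (s.measurable_rct i) ?_ hq hE ?_
  · exact (s.indep_rct_rest.comp (φ := fun w : Fin n → ℝ × 𝓧 => w i) (measurable_pi_apply i)
      measurable_id).symm
  · intro u hu
    rw [s.law_rct i]
    have := hu
    simp only [hEdef, Set.mem_ofPred_eq] at this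
    rwa [lintegral_map (hqx u) measurable_snd] at this

/-- Extension of a sample without unit `i` by an arbitrary value. -/
def extend (y : 𝓧 × Bool × ℝ) (i : Fin N)
    (w : ↥(Finset.univ.erase i : Finset (Fin N)) → 𝓧 × Bool × ℝ) (j : Fin N) : 𝓧 × Bool × ℝ :=
  if h : j ∈ (Finset.univ.erase i : Finset (Fin N)) then w ⟨j, h⟩ else y

lemma measurable_extend (y : 𝓧 × Bool × ℝ) (i : Fin N) :
    Measurable (extend y i) := by
  refine measurable_pi_lambda _ fun j => ?_
  unfold extend
  split_ifs with h
  · exact measurable_pi_apply _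
  · exact measurable_const

/-- Expected sum of squared errors over a fold. -/
lemma setLIntegral_fold_le [IsProbabilityMeasure P] [IsProbabilityMeasure Pobs] (k : Fin K)
    {g : 𝓧 × ℝ → ℝ} (hg : Measurable g) (c : ℝ≥0∞) :
    ∫⁻ ω in {ω | eLpNorm (fun x => g (x, s.contrastCF k ω x)) 2 (Pobs.map Prod.fst) ^ 2 ≤ c},
      ENNReal.ofReal (∑ i ∈ s.foldSet ω k, g ((s.obs i ω).1, s.contrastCF k ω (s.obs i ω).1) ^ 2)
        ∂P ≤ N * c := by
  obtain ⟨y⟩ : Nonempty (𝓧 × Bool × ℝ) := nonempty_of_isProbabilityMeasure Pobs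
  set F : Set Ω := {ω | eLpNorm (fun x => g (x, s.contrastCF k ω x)) 2 (Pobs.map Prod.fst) ^ 2 ≤ c}
    with hF
  have hFm : MeasurableSet F := measurableSet_le (s.measurable_lintegral_cf k hg) measurable_const
  have hG : ∀ i, MeasurableSet {ω | s.fold ω i = k} := fun i =>
    (measurable_pi_apply i).comp s.measurable_fold (measurableSet_singleton k)
  have hqi : ∀ i, Measurable fun ω => ‖g ((s.obs i ω).1, s.contrastCF k ω (s.obs i ω).1)‖ₑ ^ 2 :=
    fun i => (hg.comp ((s.measurable_obs i).fst.prodMk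
      (s.measurable_contrastCF_comp k (s.measurable_obs i).fst))).enorm.pow_const 2
  have hint : ∀ ω, ENNReal.ofReal
      (∑ i ∈ s.foldSet ω k, g ((s.obs i ω).1, s.contrastCF k ω (s.obs i ω).1) ^ 2) =
      ∑ i, {ω | s.fold ω i = k}.indicator
        (fun ω => ‖g ((s.obs i ω).1, s.contrastCF k ω (s.obs i ω).1)‖ₑ ^ 2) ω := by
    intro ω
    rw [ENNReal.ofReal_sum_of_nonneg fun _ _ => sq_nonneg _, foldSet, Finset.sum_filter]
    refine Finset.sum_congr rfl fun i _ => ?_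
    simp only [Set.indicator_apply, Set.mem_ofPred_eq]
    rw [← sq_abs, ENNReal.ofReal_pow (abs_nonneg _), Real.enorm_eq_ofReal_abs]
  simp only [hint]
  rw [lintegral_finsetSum _ fun i _ => (hqi i).indicator (hG i)]
  calc _ ≤ ∑ _ : Fin N, c := Finset.sum_le_sum fun i _ => ?_
    _ = N * c := by simp
  rw [lintegral_indicator (hG i), Measure.restrict_restrict (hG i)]
  set U : Ω → (↥(Finset.univ.erase i : Finset (Fin N)) → 𝓧 × Bool × ℝ) × (Fin N → Fin K) × 𝓤 :=
    fun ω => ((fun j => s.obs j ω), (s.fold ω, s.seed ω)) with hUdef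
  have hU0 : Measurable fun ω => fun j : ↥(Finset.univ.erase i : Finset (Fin N)) => s.obs j ω :=
    measurable_pi_lambda _ fun j => s.measurable_obs j
  have hU : Measurable U := hU0.prodMk (s.measurable_fold.prodMk s.measurable_seed)
  set ext' : (↥(Finset.univ.erase i : Finset (Fin N)) → 𝓧 × Bool × ℝ) × (Fin N → Fin K) × 𝓤 →
    (Fin N → 𝓧 × Bool × ℝ) × (Fin N → Fin K) × 𝓤 := fun u => (extend y i u.1, u.2) with hext
  have hextm : Measurable ext' :=
    ((measurable_extend y i).comp measurable_fst).prodMk measurable_snd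
  -- The heart of cross-fitting: when unit `i` lies in fold `k`, the learner for that fold does not
  -- read it, so its datum may be replaced by the arbitrary value `y`. The contrast becomes a
  -- function of variables independent of unit `i`.
  have hagree : ∀ ω, s.fold ω i = k →
      s.contrastOf k (ext' (U ω)) = s.contrastOf k (s.source ω) := by
    intro ω hω
    simp only [contrastOf, hext, hUdef, source]
    congr 1
    funext j
    have hj : (j : Fin N) ≠ i := by
      rintro hji
      have := j.2
      rw [Finset.mem_compl, Finset.mem_filter] at this
      exact this ⟨Finset.mem_univ _, by rw [hji]; exact hω⟩
    simp [extend, hj]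
  -- The fold condition is part of `E` because the replacement is harmless only there; it involves
  -- the folds alone and so keeps `E` free of unit `i`.
  set E : Set ((↥(Finset.univ.erase i : Finset (Fin N)) → 𝓧 × Bool × ℝ) × (Fin N → Fin K) × 𝓤) :=
    {u | u.2.1 i = k} ∩
      {u | ∫⁻ x, ‖g (x, s.contrastOf k (ext' u) x)‖ₑ ^ 2 ∂(Pobs.map Prod.fst) ≤ c} with hEdef
  have hE : MeasurableSet E := by
    refine MeasurableSet.inter ?_ (measurableSet_le
      ((s.measurable_lintegral_contrastOf k hg).comp hextm) measurable_const)
    have hi : Measurable fun u : (↥(Finset.univ.erase i : Finset (Fin N)) → 𝓧 × Bool × ℝ) ×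
        (Fin N → Fin K) × 𝓤 => u.2.1 i := (measurable_pi_apply i).comp measurable_snd.fst
    exact hi (measurableSet_singleton k)
  have hset : {ω | s.fold ω i = k} ∩ F = U ⁻¹' E := by
    ext ω
    simp only [Set.mem_inter_iff, Set.mem_preimage, hEdef, hF, Set.mem_ofPred_eq]
    refine and_congr_right fun hω => ?_
    rw [hagree ω hω, eLpNorm_two_sq_eq_lintegral, contrastCF_eq]
  have hq : Measurable fun q : ((↥(Finset.univ.erase i : Finset (Fin N)) → 𝓧 × Bool × ℝ) ×
      (Fin N → Fin K) × 𝓤) × (𝓧 × Bool × ℝ) =>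
      ‖g (q.2.1, s.contrastOf k (ext' q.1) q.2.1)‖ₑ ^ 2 :=
    (hg.comp (measurable_snd.fst.prodMk ((s.measurable_contrastOf k).comp
      ((hextm.comp measurable_fst).prodMk measurable_snd.fst)))).enorm.pow_const 2
  have hqx : ∀ u, Measurable fun x => ‖g (x, s.contrastOf k u x)‖ₑ ^ 2 := fun u =>
    (hg.comp (measurable_id.prodMk ((s.measurable_contrastOf k).comp
      (measurable_const.prodMk measurable_id)))).enorm.pow_const 2
  have hcongr : ∫⁻ ω in {ω | s.fold ω i = k} ∩ F,
      ‖g ((s.obs i ω).1, s.contrastCF k ω (s.obs i ω).1)‖ₑ ^ 2 ∂P =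
      ∫⁻ ω in U ⁻¹' E, ‖g ((s.obs i ω).1, s.contrastOf k (ext' (U ω)) (s.obs i ω).1)‖ₑ ^ 2 ∂P := by
    rw [hset]
    refine setLIntegral_congr_fun (hU hE) fun ω hω => ?_
    rw [hagree ω hω.1, contrastCF_eq]
  rw [hcongr]
  refine setLIntegral_le_of_indepFun hU (s.measurable_obs i) (s.indepFun_obs_rest i) hq hE ?_
  intro u hu
  rw [s.law_obs i]
  have := hu.2
  simp only [Set.mem_ofPred_eq] at this
  rwa [lintegral_map (hqx _) measurable_fst] at this

end CrossFitSample

/-! ## Gaussian coverage -/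

/-- Right continuity of the distribution function carries the inequality to the infimum; `q < 1`
makes the defining set nonempty. -/
lemma le_cdf_stdNormalQuantile {q : ℝ} (h1 : q < 1) :
    q ≤ cdf (gaussianReal 0 1) (stdNormalQuantile q) := by
  set F := cdf (gaussianReal 0 1) with hF
  have hne : {x : ℝ | q ≤ F x}.Nonempty := by
    obtain ⟨x, hx⟩ := ((tendsto_cdf_atTop (gaussianReal 0 1)).eventually_const_lt h1).exists
    exact ⟨x, hx.le⟩
  have hright := (F.right_continuous (stdNormalQuantile q)).tendsto.mono_left
    (nhdsWithin_mono _ Set.Ioi_subset_Ici_self)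
  refine ge_of_tendsto hright ?_
  filter_upwards [self_mem_nhdsWithin] with x hx
  obtain ⟨y, hy, hyx⟩ := exists_lt_of_csInf_lt hne hx
  exact le_trans hy (F.mono hyx.le)

/-- Each tail has mass at most `α / 2`, the lower one by symmetry. The strict inequality costs
nothing because the Gaussian law has no atoms. -/
lemma le_gaussianReal_abs_lt_quantile {α : ℝ} (hα : α ∈ Set.Ioo (0 : ℝ) 1) :
    ENNReal.ofReal (1 - α) ≤
      gaussianReal 0 1 {y | |y| < stdNormalQuantile (1 - α / 2)} := by
  set γ := gaussianReal 0 1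
  set z := stdNormalQuantile (1 - α / 2)
  have : NullSingletonClass γ := nullSingletonClass_gaussianReal one_ne_zero
  have hcdf : 1 - α / 2 ≤ cdf γ z :=
    le_cdf_stdNormalQuantile (by linarith [hα.1])
  have hup : γ {y | z ≤ y} ≤ ENNReal.ofReal (α / 2) := by
    have h1 : γ {y | z ≤ y} = γ (Set.Iic z)ᶜ := by
      rw [Set.compl_Iic]
      exact measure_congr Ioi_ae_eq_Ici.symm
    rw [h1, prob_compl_eq_one_sub measurableSet_Iic, ← ofReal_cdf, ← ENNReal.ofReal_one,
      ← ENNReal.ofReal_sub _ (cdf_nonneg γ z)]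
    exact ENNReal.ofReal_le_ofReal (by linarith)
  have hlow : γ {y | y ≤ -z} ≤ ENNReal.ofReal (α / 2) := by
    refine le_trans (le_of_eq ?_) hup
    have hneg : γ.map (fun y => -y) = γ := by
      simpa using gaussianReal_map_neg (μ := 0) (v := 1)
    conv_lhs => rw [← hneg]
    have hm : MeasurableSet {y : ℝ | y ≤ -z} := measurableSet_Iic
    rw [Measure.map_apply measurable_neg hm]
    congr 1
    ext y
    simp
  have hmeas : MeasurableSet {y : ℝ | |y| < z} := measurableSet_lt (by fun_prop) measurable_const
  have hcompl : γ {y : ℝ | |y| < z}ᶜ ≤ ENNReal.ofReal α := by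
    refine (measure_mono (t := {y | z ≤ y} ∪ {y | y ≤ -z}) fun y hy => ?_).trans
      ((measure_union_le _ _).trans ((add_le_add hup hlow).trans (le_of_eq ?_)))
    · simp only [Set.mem_compl_iff, Set.mem_ofPred_eq, not_lt, le_abs] at hy
      exact hy.imp id fun h => by simp only [Set.mem_ofPred_eq]; linarith
    · rw [← ENNReal.ofReal_add (by linarith [hα.1]) (by linarith [hα.1]), add_halves]
  have hsum := prob_add_prob_compl (μ := γ) hmeas
  rw [ENNReal.ofReal_sub _ hα.1.le, ENNReal.ofReal_one, tsub_le_iff_right, ← hsum]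
  gcongr

lemma le_gaussianReal_abs_lt_scaled {α : ℝ} (hα : α ∈ Set.Ioo (0 : ℝ) 1) {v : ℝ} (hv : 0 < v) :
    ENNReal.ofReal (1 - α) ≤
      gaussianReal 0 v.toNNReal {x | |x| < stdNormalQuantile (1 - α / 2) * √v} := by
  have hmap : (gaussianReal 0 1).map (fun y => √v * y) = gaussianReal 0 v.toNNReal := by
    rw [gaussianReal_map_const_mul]
    congr 1
    · simp
    · ext
      simp [Real.sq_sqrt hv.le, hv.le]
  rw [← hmap, Measure.map_apply (by fun_prop) (measurableSet_lt (by fun_prop) measurable_const)]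
  refine (le_gaussianReal_abs_lt_quantile hα).trans (measure_mono fun y hy => ?_)
  have hs : 0 < √v := Real.sqrt_pos.2 hv
  simp only [Set.mem_preimage, Set.mem_ofPred_eq, abs_mul, abs_of_pos hs] at hy ⊢
  rw [mul_comm]
  gcongr

/-- If `T` is asymptotically `N(0, v)` and `W` is consistent for `v > 0`, then
`|T| ≤ z √W` has asymptotic probability at least the nominal level. -/
lemma le_liminf_coverage {Ω : Type*} [MeasurableSpace Ω] {P : Measure Ω} [IsProbabilityMeasure P]
    {T W : ℕ → Ω → ℝ} {v : ℝ} (hv : 0 < v)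
    (hT : TendstoInDistribution T atTop (id : ℝ → ℝ) (fun _ => P) (gaussianReal 0 v.toNNReal))
    (hW : Tendsto (fun z : ℕ × Ω => W z.1 z.2) (probFilter P) (𝓝 v)) {α : ℝ}
    (hα : α ∈ Set.Ioo (0 : ℝ) 1) {A : ℕ → Set Ω}
    (hA : ∀ᶠ t in atTop,
      {ω | |T t ω| < stdNormalQuantile (1 - α / 2) * √(W t ω)} ⊆ A t) :
    ENNReal.ofReal (1 - α) ≤ liminf (fun t => P (A t)) atTop := by
  set q := stdNormalQuantile (1 - α / 2) with hq
  set c := q * √v with hc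
  set ν := gaussianReal 0 v.toNNReal with hν
  -- Slightly shorter open intervals exhaust `|x| < c`. The slack absorbs the fluctuation of `√W`
  -- around `√v`, and openness lets the portmanteau theorem bound the liminf from below.
  have hmono : Monotone fun k : ℕ => {x : ℝ | |x| < c - 1 / ((k : ℝ) + 1)} := by
    intro i j hij x hx
    simp only [Set.mem_ofPred_eq] at hx ⊢
    have := Nat.one_div_le_one_div (α := ℝ) hij
    linarith
  have hunion : ⋃ k : ℕ, {x : ℝ | |x| < c - 1 / ((k : ℝ) + 1)} = {x | |x| < c} := by
    ext x
    simp only [Set.mem_iUnion, Set.mem_ofPred_eq]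
    constructor
    · rintro ⟨k, hk⟩
      have : (0 : ℝ) < 1 / ((k : ℝ) + 1) := by positivity
      linarith
    · intro hx
      obtain ⟨k, hk⟩ := exists_nat_one_div_lt (sub_pos.2 hx)
      exact ⟨k, by linarith⟩
  have hlim := tendsto_measure_iUnion_atTop (μ := ν) hmono
  rw [hunion] at hlim
  refine le_of_forall_lt fun a ha => ?_
  have hac : a < ν {x | |x| < c} := ha.trans_le (le_gaussianReal_abs_lt_scaled hα hv)
  -- The gap `a₂ - a₁` will pay for the event on which `q √W` falls below the shortened bound `c -
  -- η`.
  obtain ⟨a₁, haa₁, ha₁⟩ := exists_between hac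
  obtain ⟨a₂, ha₁₂, ha₂⟩ := exists_between ha₁
  obtain ⟨k, hk⟩ := (hlim.eventually_const_lt ha₂).exists
  set η : ℝ := 1 / ((k : ℝ) + 1) with hη
  have hη0 : 0 < η := by positivity
  have hopen : IsOpen {x : ℝ | |x| < c - η} := isOpen_lt continuous_abs continuous_const
  have hport := ProbabilityMeasure.le_liminf_measure_open_of_tendsto hT.tendsto hopen
  simp only [ProbabilityMeasure.coe_mk, Measure.map_id] at hport
  have hev := eventually_lt_of_lt_liminf (hk.trans_le hport)
  have hbad := eventually_probFilter.1
    (((hW.sqrt.const_mul q).eventually_const_lt (show c - η < c by linarith)))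
  have hbad' := hbad.eventually_lt_const (tsub_pos_of_lt ha₁₂)
  refine haa₁.trans_le (le_liminf_of_le (by isBoundedDefault) ?_)
  filter_upwards [hev, hbad', hA] with t h1 h2 h3
  rw [Measure.map_apply_of_aemeasurable (hT.forall_aemeasurable t) hopen.measurableSet] at h1
  have hsub : T t ⁻¹' {x : ℝ | |x| < c - η} ⊆ A t ∪ {ω | ¬ c - η < q * √(W t ω)} := by
    intro ω hω
    by_cases hb : c - η < q * √(W t ω)
    · exact Or.inl (h3 (lt_trans hω hb))
    · exact Or.inr hb
  have h4 := (measure_mono (μ := P) hsub).trans (measure_union_le _ _)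
  have h5 : a₂ ≤ P (A t) + (a₂ - a₁) := h1.le.trans (h4.trans (by gcongr))
  have ha₂top : a₂ ≠ ∞ := ha₂.ne_top
  have h6 : a₂ = a₁ + (a₂ - a₁) := (add_tsub_cancel_of_le ha₁₂.le).symm
  have h7 : a₁ + (a₂ - a₁) ≤ P (A t) + (a₂ - a₁) := h6 ▸ h5
  exact (ENNReal.add_le_add_iff_right (ENNReal.sub_ne_top ha₂top)).1 h7

/-! ## Population regression -/

section Population

variable {𝓧 : Type*} [MeasurableSpace 𝓧] {p : ℕ}

lemma IsTreatmentContrast.measurable {Pobs : Measure (𝓧 × Bool × ℝ)} {Δ : 𝓧 → ℝ}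
    (h : IsTreatmentContrast Pobs Δ) : Measurable Δ := by
  obtain ⟨-, m, hm, -, hΔ⟩ := h
  have : Δ = fun x => m (x, true) - m (x, false) := funext hΔ
  rw [this]
  fun_prop

lemma measurable_coord {ψ : ℝ → EuclideanSpace ℝ (Fin p)} (hψ : Measurable ψ) (j : Fin p) :
    Measurable fun y => ψ y j :=
  (PiLp.continuous_apply 2 _ j).measurable.comp hψ

lemma measurable_calibrate {ψ : ℝ → EuclideanSpace ℝ (Fin p)} (hψ : Measurable ψ)
    (b : Fin p → ℝ) : Measurable (calibrate ψ b) :=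
  Finset.measurable_sum _ fun j _ => (measurable_coord hψ j).const_mul _

/-- First-order conditions of the best calibration. -/
lemma IsBestCalibration.exists_coeff {Prct : Measure (ℝ × 𝓧)} [IsProbabilityMeasure Prct]
    {ψ : ℝ → EuclideanSpace ℝ (Fin p)} {Δ μbar : 𝓧 → ℝ}
    (h : IsBestCalibration Prct ψ Δ μbar) (hD : MemLp (fun w : ℝ × 𝓧 => w.1) 2 Prct)
    (hψ : ∀ j, MemLp (fun w : ℝ × 𝓧 => ψ (Δ w.2) j) 2 Prct) :
    ∃ β₀ : Fin p → ℝ, (∀ x, μbar x = ∑ j, β₀ j * ψ (Δ x) j) ∧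
      MemLp (fun w : ℝ × 𝓧 => w.1 - μbar w.2) 2 Prct ∧
      ∀ j, ∫ w, (w.1 - μbar w.2) * ψ (Δ w.2) j ∂Prct = 0 := by
  obtain ⟨⟨β₀, hβ₀⟩, hmin⟩ := h
  have hμ : ∀ x, μbar x = ∑ j, β₀ j * ψ (Δ x) j := fun x => by rw [hβ₀]; rfl
  have he : MemLp (fun w : ℝ × 𝓧 => w.1 - μbar w.2) 2 Prct := by
    simp only [hμ]
    exact hD.sub (memLp_finsetSum _ fun j _ => (hψ j).const_mul _)
  refine ⟨β₀, hμ, he, fun j => linear_coeff_eq_zero_of_quadratic_nonneg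
    (C := ∫ w, ψ (Δ w.2) j ^ 2 ∂Prct) fun t => ?_⟩
  have hmem : (fun x => calibrate ψ (fun l => β₀ l + if l = j then t else 0) (Δ x)) ∈
      calibrationClass ψ Δ := ⟨_, rfl⟩
  have hle := hmin hmem
  simp only [Set.mem_ofPred_eq] at hle
  have hsq : ∀ w : ℝ × 𝓧,
      (w.1 - calibrate ψ (fun l => β₀ l + if l = j then t else 0) (Δ w.2)) ^ 2 =
      (w.1 - μbar w.2) ^ 2 + (-(2 * t) * ((w.1 - μbar w.2) * ψ (Δ w.2) j) +
        t ^ 2 * ψ (Δ w.2) j ^ 2) := by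
    intro w
    have : calibrate ψ (fun l => β₀ l + if l = j then t else 0) (Δ w.2) =
        μbar w.2 + t * ψ (Δ w.2) j := by
      simp [calibrate, hμ, add_mul, Finset.sum_add_distrib]
    rw [this]
    ring
  have hi1 := he.integrable_sq
  have hi2 : Integrable (fun w : ℝ × 𝓧 => (w.1 - μbar w.2) * ψ (Δ w.2) j) Prct :=
    he.integrable_mul (hψ j)
  have hi3 := (hψ j).integrable_sq
  simp only [hsq] at hle
  have hi4 : Integrable (fun w : ℝ × 𝓧 => -(2 * t) * ((w.1 - μbar w.2) * ψ (Δ w.2) j) +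
      t ^ 2 * ψ (Δ w.2) j ^ 2) Prct := (hi2.const_mul _).add (hi3.const_mul _)
  rw [integral_add hi1 hi4,
    integral_add (hi2.const_mul _) (hi3.const_mul _), integral_const_mul,
    integral_const_mul] at hle
  linarith

/-- The asymptotic variance is the variance of the linearized score. -/
lemma variance_linear_score {Prct : Measure (ℝ × 𝓧)} [IsProbabilityMeasure Prct]
    {Pobs : Measure (𝓧 × Bool × ℝ)} {ψ : ℝ → EuclideanSpace ℝ (Fin p)} {Δ μbar : 𝓧 → ℝ}
    (hscore : ∀ j, MemLp (fun w : ℝ × 𝓧 => (w.1 - μbar w.2) * ψ (Δ w.2) j) 2 Prct)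
    (h0 : ∀ j, ∫ w, (w.1 - μbar w.2) * ψ (Δ w.2) j ∂Prct = 0) {a : Fin p → ℝ}
    (ha : a = alphaBar (Prct.map Prod.snd) (Pobs.map Prod.fst) ψ Δ) :
    MemLp (fun w : ℝ × 𝓧 => ∑ j, (w.1 - μbar w.2) * ψ (Δ w.2) j * a j) 2 Prct ∧
    ∫ w, ∑ j, (w.1 - μbar w.2) * ψ (Δ w.2) j * a j ∂Prct = 0 ∧
    Var[fun w : ℝ × 𝓧 => ∑ j, (w.1 - μbar w.2) * ψ (Δ w.2) j * a j; Prct] =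
      asympVar Prct Pobs ψ Δ μbar := by
  have hm : MemLp (fun w : ℝ × 𝓧 => ∑ j, (w.1 - μbar w.2) * ψ (Δ w.2) j * a j) 2 Prct :=
    memLp_finsetSum _ fun j _ => (hscore j).mul_const _
  have hz : ∫ w, ∑ j, (w.1 - μbar w.2) * ψ (Δ w.2) j * a j ∂Prct = 0 := by
    rw [integral_finsetSum _ fun j _ => ((hscore j).mul_const _).integrable one_le_two]
    refine Finset.sum_eq_zero fun j _ => ?_
    rw [integral_mul_const, h0, zero_mul]
  refine ⟨hm, hz, ?_⟩
  have hi : ∀ j k, Integrable (fun w : ℝ × 𝓧 => a j * (((w.1 - μbar w.2) * ψ (Δ w.2) j) *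
      ((w.1 - μbar w.2) * ψ (Δ w.2) k) * a k)) Prct := fun j k =>
    ((MemLp.integrable_mul (hscore j) (hscore k)).mul_const _).const_mul _
  rw [variance_of_integral_eq_zero hm.aemeasurable hz, asympVar, ← ha]
  simp only [dotProduct, Matrix.mulVec, meatMatrix, Matrix.of_apply, Finset.mul_sum]
  have hsq : ∀ w : ℝ × 𝓧, (∑ j, (w.1 - μbar w.2) * ψ (Δ w.2) j * a j) ^ 2 =
      ∑ j, ∑ k, a j * (((w.1 - μbar w.2) * ψ (Δ w.2) j) *
        ((w.1 - μbar w.2) * ψ (Δ w.2) k) * a k) := by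
    intro w
    rw [sq, Finset.sum_mul_sum]
    exact Finset.sum_congr rfl fun j _ => Finset.sum_congr rfl fun k _ => by ring
  simp only [hsq]
  rw [integral_finsetSum _ fun j _ => integrable_finsetSum _ fun k _ => hi j k]
  refine Finset.sum_congr rfl fun j _ => ?_
  rw [integral_finsetSum _ fun k _ => hi j k]
  refine Finset.sum_congr rfl fun k _ => ?_
  rw [integral_const_mul, integral_mul_const]
  congr 2
  exact integral_congr_ae (ae_of_all _ fun w => by ring)

end Population

/-! ## Sequences of cross-fit samples -/

section CrossFit

variable {Ω 𝓧 𝓤 : Type*} [MeasurableSpace Ω] [MeasurableSpace 𝓧] [MeasurableSpace 𝓤]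
  {P : Measure Ω} {Prct : Measure (ℝ × 𝓧)} {Pobs : Measure (𝓧 × Bool × ℝ)}

lemma CrossFitSample.sum_foldSet {n N K : ℕ} (s : CrossFitSample 𝓤 P Prct Pobs n N K) (ω : Ω)
    (F : Fin K → Fin N → ℝ) : ∑ k, ∑ i ∈ s.foldSet ω k, F k i = ∑ i, F (s.fold ω i) i := by
  simp only [CrossFitSample.foldSet, Finset.sum_filter]
  rw [Finset.sum_comm]
  simp

variable {p : ℕ} {ψ : ℝ → EuclideanSpace ℝ (Fin p)} {Δ : 𝓧 → ℝ} {n N : ℕ → ℕ} {K : ℕ}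
  (S : ∀ t, CrossFitSample 𝓤 P Prct Pobs (n t) (N t) K)

/-- Regressors of the experimental units. -/
noncomputable def rctRegressor (ψ : ℝ → EuclideanSpace ℝ (Fin p)) (Δ : 𝓧 → ℝ) (j : Fin p)
    (z : ℕ × Ω) (i : Fin (n z.1)) : ℝ := ψ (Δ ((S z.1).rct i z.2).2) j

/-- Errors of the estimated regressors of the experimental units. -/
noncomputable def rctError (ψ : ℝ → EuclideanSpace ℝ (Fin p)) (Δ : 𝓧 → ℝ) (j : Fin p)
    (z : ℕ × Ω) (i : Fin (n z.1)) : ℝ :=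
  ψ ((S z.1).contrastAvg z.2 ((S z.1).rct i z.2).2) j - ψ (Δ ((S z.1).rct i z.2).2) j

/-- Regressors of the observational units. -/
noncomputable def obsRegressor (ψ : ℝ → EuclideanSpace ℝ (Fin p)) (Δ : 𝓧 → ℝ) (j : Fin p)
    (z : ℕ × Ω) (i : Fin (N z.1)) : ℝ := ψ (Δ ((S z.1).obs i z.2).1) j

/-- Errors of the cross-fit regressors of the observational units. -/
noncomputable def obsError (ψ : ℝ → EuclideanSpace ℝ (Fin p)) (Δ : 𝓧 → ℝ) (j : Fin p)
    (z : ℕ × Ω) (i : Fin (N z.1)) : ℝ :=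
  ψ ((S z.1).contrastCF ((S z.1).fold z.2 i) z.2 ((S z.1).obs i z.2).1) j -
    ψ (Δ ((S z.1).obs i z.2).1) j

/-- The average cross-fit regressor over the observational sample. -/
noncomputable def obsMean (ψ : ℝ → EuclideanSpace ℝ (Fin p)) (z : ℕ × Ω) (j : Fin p) : ℝ :=
  (N z.1 : ℝ)⁻¹ * ∑ k, ∑ i ∈ (S z.1).foldSet z.2 k,
    ψ ((S z.1).contrastCF k z.2 ((S z.1).obs i z.2).1) j

lemma obsMean_eq (z : ℕ × Ω) (j : Fin p) : obsMean S ψ z j =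
    (N z.1 : ℝ)⁻¹ * ∑ i, (obsRegressor S ψ Δ j z i + obsError S ψ Δ j z i) := by
  rw [obsMean, (S z.1).sum_foldSet z.2
    fun k i => ψ ((S z.1).contrastCF k z.2 ((S z.1).obs i z.2).1) j]
  simp only [obsRegressor, obsError, add_sub_cancel]

/-- The coefficient is common to all folds, so the point estimate is the bilinear functional `βᵀb̂`
treated by the least squares expansion. -/
lemma tauHat_eq (z : ℕ × Ω) (b : Fin p → ℝ) :
    (S z.1).tauHat ψ b z.2 = b ⬝ᵥ obsMean S ψ z := by
  simp only [CrossFitSample.tauHat, calibrate, obsMean, dotProduct, Finset.mul_sum]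
  rw [(S z.1).sum_foldSet z.2
    fun k i => ∑ j, (N z.1 : ℝ)⁻¹ * (b j * ψ ((S z.1).contrastCF k z.2 ((S z.1).obs i z.2).1) j),
    Finset.sum_comm]
  refine Finset.sum_congr rfl fun j _ => ?_
  rw [(S z.1).sum_foldSet z.2
    fun k i => b j * ((N z.1 : ℝ)⁻¹ * ψ ((S z.1).contrastCF k z.2 ((S z.1).obs i z.2).1) j)]
  exact Finset.sum_congr rfl fun i _ => by ring

variable [IsProbabilityMeasure P] [IsProbabilityMeasure Prct] [IsProbabilityMeasure Pobs]

omit [IsProbabilityMeasure P] [IsProbabilityMeasure Prct] [IsProbabilityMeasure Pobs] in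
lemma iidRows_rct : IIDRows P Prct n fun t => (S t).rct :=
  ⟨fun t => (S t).measurable_rct, fun t => (S t).law_rct, fun t => (S t).indep_rct⟩

omit [IsProbabilityMeasure P] [IsProbabilityMeasure Prct] [IsProbabilityMeasure Pobs] in
lemma iidRows_obs : IIDRows P Pobs N fun t => (S t).obs :=
  ⟨fun t => (S t).measurable_obs, fun t => (S t).law_obs, fun t => (S t).indep_obs⟩

/-! ### From the rate condition to vanishing regressor errors. -/

/-- The rate condition on the estimated regressors. -/
def RegressorRate (ψ : ℝ → EuclideanSpace ℝ (Fin p)) (Δ : 𝓧 → ℝ) : Prop :=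
  ∀ (j : Fin p) (k : Fin K), IsLittleOp P (fun t ω =>
    eLpNorm (fun x => ψ ((S t).contrastAvg ω x) j - ψ (Δ x) j) 2 (Prct.map Prod.snd) +
    eLpNorm (fun x => ψ ((S t).contrastCF k ω x) j - ψ (Δ x) j) 2 (Pobs.map Prod.fst))
    fun t => (√(n t : ℝ))⁻¹

variable {S}

-- Here the number of summands is the `n` of the rate, so the ratio in `tendsto_of_setLIntegral_le`
-- is 1 and the sum itself vanishes. Positivity of `K` supplies a fold index at which to use the
-- rate condition.
omit [IsProbabilityMeasure Pobs] in
lemma RegressorRate.sumSqNull_rctError (hR : RegressorRate S ψ Δ) (hψ : Measurable ψ)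
    (hΔ : Measurable Δ) (hK : 0 < K) (hn : Tendsto n atTop atTop) (j : Fin p) :
    SumSqNull (probFilter P) (rctError S ψ Δ j) := by
  have hg : Measurable fun q : 𝓧 × ℝ => ψ q.2 j - ψ (Δ q.1) j :=
    ((measurable_coord hψ j).comp measurable_snd).sub
      ((measurable_coord hψ j).comp (hΔ.comp measurable_fst))
  have h := tendsto_of_setLIntegral_le (P := P) hn hn
    (Q := fun t ω => ∑ i, (ψ ((S t).contrastAvg ω ((S t).rct i ω).2) j -
      ψ (Δ ((S t).rct i ω).2) j) ^ 2)
    (fun t ω => Finset.sum_nonneg fun _ _ => sq_nonneg _) (fun t => ?_)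
    (fun t => (S t).measurable_lintegral_avg hg)
    (fun t ω => pow_le_pow_left' le_self_add 2) (hR j ⟨0, hK⟩)
    (fun t c => (S t).setLIntegral_rct_le hg c)
  · refine h.congr' ?_
    filter_upwards [(hn.comp tendsto_fst_probFilter).eventually_gt_atTop 0] with z hz
    have hz' : (n z.1 : ℝ) ≠ 0 := (Nat.cast_pos.2 hz).ne'
    simp only [rctError]
    rw [div_self hz', one_mul]
  · exact Finset.measurable_sum _ fun i _ => (hg.comp (((S t).measurable_rct i).snd.prodMk
      ((S t).measurable_contrastAvg_comp ((S t).measurable_rct i).snd))).pow_const 2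

-- Independence holds only between the units of a fold and the learner of that fold, so the bound is
-- proved fold by fold and summed over the fixed number `K` of folds.
omit [IsProbabilityMeasure Prct] in
lemma RegressorRate.tendsto_obsError (hR : RegressorRate S ψ Δ) (hψ : Measurable ψ)
    (hΔ : Measurable Δ) (hn : Tendsto n atTop atTop) (hN : Tendsto N atTop atTop) (j : Fin p) :
    Tendsto (fun z : ℕ × Ω => (n z.1 : ℝ) / (N z.1 : ℝ) * ∑ i, obsError S ψ Δ j z i ^ 2)
      (probFilter P) (𝓝 0) := by
  have hg : Measurable fun q : 𝓧 × ℝ => ψ q.2 j - ψ (Δ q.1) j :=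
    ((measurable_coord hψ j).comp measurable_snd).sub
      ((measurable_coord hψ j).comp (hΔ.comp measurable_fst))
  have h : ∀ k : Fin K, Tendsto (fun z : ℕ × Ω => (n z.1 : ℝ) / (N z.1 : ℝ) *
      ∑ i ∈ (S z.1).foldSet z.2 k, (ψ ((S z.1).contrastCF k z.2 ((S z.1).obs i z.2).1) j -
        ψ (Δ ((S z.1).obs i z.2).1) j) ^ 2) (probFilter P) (𝓝 0) := by
    intro k
    refine tendsto_of_setLIntegral_le hn hN
      (Q := fun t ω => ∑ i ∈ (S t).foldSet ω k, (ψ ((S t).contrastCF k ω ((S t).obs i ω).1) j -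
        ψ (Δ ((S t).obs i ω).1) j) ^ 2)
      (fun t ω => Finset.sum_nonneg fun _ _ => sq_nonneg _) (fun t => ?_)
      (fun t => (S t).measurable_lintegral_cf k hg)
      (fun t ω => pow_le_pow_left' le_add_self 2) (hR j k)
      (fun t c => (S t).setLIntegral_fold_le k hg c)
    simp only [CrossFitSample.foldSet, Finset.sum_filter]
    refine Finset.measurable_sum _ fun i _ => Measurable.ite ?_ ?_ measurable_const
    · exact (measurable_pi_apply i).comp (S t).measurable_fold (measurableSet_singleton k)
    · exact (hg.comp (((S t).measurable_obs i).fst.prodMk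
        ((S t).measurable_contrastCF_comp k ((S t).measurable_obs i).fst))).pow_const 2
  have hsum := tendsto_finsetSum Finset.univ fun k (_ : k ∈ Finset.univ) => h k
  rw [Finset.sum_const_zero] at hsum
  refine hsum.congr fun z => ?_
  rw [← Finset.mul_sum, (S z.1).sum_foldSet z.2
    fun k i => (ψ ((S z.1).contrastCF k z.2 ((S z.1).obs i z.2).1) j -
        ψ (Δ ((S z.1).obs i z.2).1) j) ^ 2]
  rfl

omit [IsProbabilityMeasure Prct] in
/-- The average cross-fit regressor converges faster than `n^(-1/2)`. -/
lemma RegressorRate.sqrt_mul_obsMean_sub (hR : RegressorRate S ψ Δ) (hψ : Measurable ψ)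
    (hΔ : Measurable Δ) (hψ_obs : ∀ j, MemLp (fun x => ψ (Δ x) j) 2 (Pobs.map Prod.fst))
    (hn : Tendsto n atTop atTop) (hN : Tendsto N atTop atTop)
    (hnN : Tendsto (fun t => (n t : ℝ) / (N t : ℝ)) atTop (𝓝 0)) (j : Fin p) :
    Tendsto (fun z : ℕ × Ω =>
      √(n z.1 : ℝ) * (obsMean S ψ z j - ∫ x, ψ (Δ x) j ∂(Pobs.map Prod.fst)))
      (probFilter P) (𝓝 0) := by
  set b := ∫ x, ψ (Δ x) j ∂(Pobs.map Prod.fst) with hb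
  have hm : Measurable fun o : 𝓧 × Bool × ℝ => ψ (Δ o.1) j :=
    (measurable_coord hψ j).comp (hΔ.comp measurable_fst)
  have hL : MemLp (fun o : 𝓧 × Bool × ℝ => ψ (Δ o.1) j) 2 Pobs :=
    (hψ_obs j).comp_of_map measurable_fst.aemeasurable
  have hLb : MemLp (fun o : 𝓧 × Bool × ℝ => ψ (Δ o.1) j - b) 2 Pobs :=
    hL.sub (memLp_const b)
  have hmean : ∫ o, (ψ (Δ o.1) j - b) ∂Pobs = 0 := by
    have : ∫ o, ψ (Δ o.1) j ∂Pobs = b := by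
      rw [hb, integral_map measurable_fst.aemeasurable (hψ_obs j).aestronglyMeasurable]
    rw [integral_sub (hL.integrable one_le_two) (integrable_const b), this]
    simp
  -- The sampling error of the mean has order `N^(-1/2)`; multiplied by `√n` it is `√(n/N)` times a
  -- sequence bounded in probability.
  have h1 := ((iidRows_obs S).bddInProb (hm.sub_const b) hLb hmean).mul_tendsto_zero
    (Y := fun z => √((n z.1 : ℝ) / (N z.1 : ℝ)))
    (by simpa using (hnN.comp (tendsto_fst_probFilter (P := P))).sqrt)
  -- By Cauchy–Schwarz, the square of the learner's contribution is at most `n/N` times its sum of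
  -- squared errors.
  have h2 : Tendsto (fun z : ℕ × Ω =>
      √(n z.1 : ℝ) * ((N z.1 : ℝ)⁻¹ * ∑ i, obsError S ψ Δ j z i)) (probFilter P) (𝓝 0) := by
    refine tendsto_zero_of_sq_le (Eventually.of_forall fun z => ?_)
      (hR.tendsto_obsError hψ hΔ hn hN j)
    have hcs := sq_sum_le_card_mul_sum_sq (s := Finset.univ) (f := obsError S ψ Δ j z)
    rw [Finset.card_univ, Fintype.card_fin] at hcs
    rw [mul_pow, Real.sq_sqrt (Nat.cast_nonneg _), mul_pow]
    rcases Nat.eq_zero_or_pos (N z.1) with h0 | h0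
    · simp [h0]
    · have h0' : (0 : ℝ) < N z.1 := Nat.cast_pos.2 h0
      calc (n z.1 : ℝ) * ((N z.1 : ℝ)⁻¹ ^ 2 * (∑ i, obsError S ψ Δ j z i) ^ 2)
          ≤ (n z.1 : ℝ) * ((N z.1 : ℝ)⁻¹ ^ 2 * (N z.1 * ∑ i, obsError S ψ Δ j z i ^ 2)) := by
            gcongr
        _ = _ := by field_simp
  have h3 := h1.add h2
  rw [add_zero] at h3
  refine h3.congr' ?_
  filter_upwards [(hN.comp tendsto_fst_probFilter).eventually_gt_atTop 0] with z hz
  have h0 : (0 : ℝ) < N z.1 := Nat.cast_pos.2 hz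
  have hs : √(N z.1 : ℝ) ≠ 0 := (Real.sqrt_pos.2 h0).ne'
  have hsq : √(N z.1 : ℝ) ^ 2 = N z.1 := Real.sq_sqrt h0.le
  rw [obsMean_eq S (Δ := Δ), Finset.sum_add_distrib, Finset.sum_sub_distrib, Finset.sum_const,
    Finset.card_univ, Fintype.card_fin, nsmul_eq_mul, Real.sqrt_div' _ h0.le]
  simp only [obsRegressor]
  field_simp
  rw [hsq]
  ring

end CrossFit

/-! ### The least squares expansion and variance estimate for the cross-fit data. -/

section Estimator

variable {Ω 𝓧 𝓤 : Type*} [MeasurableSpace Ω] [MeasurableSpace 𝓧] [MeasurableSpace 𝓤]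
  {P : Measure Ω} {Prct : Measure (ℝ × 𝓧)} {Pobs : Measure (𝓧 × Bool × ℝ)}
  {p : ℕ} {ψ : ℝ → EuclideanSpace ℝ (Fin p)} {Δ : 𝓧 → ℝ} {n N : ℕ → ℕ} {K : ℕ}
  {S : ∀ t, CrossFitSample 𝓤 P Prct Pobs (n t) (N t) K}

/-- Residuals of the best calibration for the experimental units. -/
def rctResid (S : ∀ t, CrossFitSample 𝓤 P Prct Pobs (n t) (N t) K) (μbar : 𝓧 → ℝ) (z : ℕ × Ω)
    (i : Fin (n z.1)) : ℝ :=
  ((S z.1).rct i z.2).1 - μbar ((S z.1).rct i z.2).2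

/-- This joins probability to the deterministic expansion: the law of large numbers gives the Gram
limit and the residual bound, the rate condition the perturbation, least squares the normal
equations, and Chebyshev's inequality for the centered score its boundedness. -/
lemma perturbedLS_crossFit [IsProbabilityMeasure P] [IsProbabilityMeasure Prct]
    (hR : RegressorRate S ψ Δ) (hψ : Measurable ψ) (hΔ : Measurable Δ) (hK : 0 < K)
    (hn : Tendsto n atTop atTop) (hψ_rct : ∀ j, MemLp (fun x => ψ (Δ x) j) 2 (Prct.map Prod.snd))
    (hgram : IsUnit (gramMatrix (Prct.map Prod.snd) ψ Δ)) {μbar : 𝓧 → ℝ} {β₀ : Fin p → ℝ}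
    (hμ : ∀ x, μbar x = ∑ j, β₀ j * ψ (Δ x) j)
    (he : MemLp (fun w : ℝ × 𝓧 => w.1 - μbar w.2) 2 Prct)
    (hscore : ∀ j, MemLp (fun w : ℝ × 𝓧 => (w.1 - μbar w.2) * ψ (Δ w.2) j) 2 Prct)
    (h0 : ∀ j, ∫ w, (w.1 - μbar w.2) * ψ (Δ w.2) j ∂Prct = 0)
    {β : ℕ → Ω → Fin p → ℝ} (hβ : ∀ t ω, (S t).IsOLS ψ ω (β t ω)) :
    PerturbedLS (probFilter P) (fun z : ℕ × Ω => n z.1) (rctRegressor S ψ Δ) (rctError S ψ Δ)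
      (rctResid S μbar) β₀ (fun z => β z.1 z.2) (gramMatrix (Prct.map Prod.snd) ψ Δ) := by
  have hφm : ∀ j, Measurable fun w : ℝ × 𝓧 => ψ (Δ w.2) j := fun j =>
    (measurable_coord hψ j).comp (hΔ.comp measurable_snd)
  have hμm : Measurable μbar := by
    have : μbar = fun x => calibrate ψ β₀ (Δ x) := funext hμ
    rw [this]
    exact (measurable_calibrate hψ β₀).comp hΔ
  have hem : Measurable fun w : ℝ × 𝓧 => w.1 - μbar w.2 :=
    measurable_fst.sub (hμm.comp measurable_snd)
  have hφL : ∀ j, MemLp (fun w : ℝ × 𝓧 => ψ (Δ w.2) j) 2 Prct := fun j =>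
    (hψ_rct j).comp_of_map measurable_snd.aemeasurable
  refine ⟨hn.comp tendsto_fst_probFilter, fun j k => ?_, hgram, ?_,
    hR.sumSqNull_rctError hψ hΔ hK hn, fun z j => ?_, fun j Y hY => ?_⟩
  · have h := (iidRows_rct S).tendsto_mean hn (f := fun w => ψ (Δ w.2) j * ψ (Δ w.2) k)
      ((hφm j).mul (hφm k)) (MemLp.integrable_mul (hφL j) (hφL k))
    have hG : gramMatrix (Prct.map Prod.snd) ψ Δ j k = ∫ w, ψ (Δ w.2) j * ψ (Δ w.2) k ∂Prct := by
      rw [gramMatrix, Matrix.of_apply, integral_map measurable_snd.aemeasurable]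
      exact (hψ_rct j).aestronglyMeasurable.mul (hψ_rct k).aestronglyMeasurable
    rw [hG]
    exact h
  · have h := (iidRows_rct S).tendsto_mean hn (f := fun w => (w.1 - μbar w.2) ^ 2)
      (hem.pow_const 2) he.integrable_sq
    exact MeanSqBdd.of_tendsto (a := rctResid S μbar) h
  · have h := sum_resid_mul_eq_zero (fun i => ((S z.1).rct i z.2).1)
      (fun i k => ψ ((S z.1).contrastAvg z.2 ((S z.1).rct i z.2).2) k) (β z.1 z.2)
      (hβ z.1 z.2) j
    refine (Finset.sum_congr rfl fun i _ => ?_).trans h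
    simp only [rctRegressor, rctError, rctResid, hμ, sub_add_cancel, add_sub_cancel]
  · have h := (iidRows_rct S).bddInProb (f := fun w => (w.1 - μbar w.2) * ψ (Δ w.2) j)
      (hem.mul (hφm j)) (hscore j) (h0 j)
    exact h.mul_tendsto_zero hY

lemma aemeasurable_tauHat {n N K : ℕ} (s : CrossFitSample 𝓤 P Prct Pobs n N K)
    (hψ : Measurable ψ) {β : Ω → Fin p → ℝ} (hβ : AEMeasurable β P) :
    AEMeasurable (fun ω => s.tauHat ψ (β ω) ω) P := by
  simp only [CrossFitSample.tauHat, CrossFitSample.foldSet, Finset.sum_filter, calibrate]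
  refine AEMeasurable.const_mul (Finset.aemeasurable_fun_sum _ fun k _ =>
    Finset.aemeasurable_fun_sum _ fun i _ => ?_) _
  have hset : MeasurableSet {ω | s.fold ω i = k} :=
    ((measurable_pi_apply i).comp s.measurable_fold) (measurableSet_singleton k)
  have hsum : AEMeasurable
      (fun ω => ∑ j, β ω j * ψ (s.contrastCF k ω (s.obs i ω).1) j) P :=
    Finset.aemeasurable_fun_sum _ fun j _ => ((measurable_pi_apply j).comp_aemeasurable hβ).mul
      ((measurable_coord hψ j).comp
        (s.measurable_contrastCF_comp k (s.measurable_obs i).fst)).aemeasurable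
  refine (hsum.indicator hset).congr (ae_of_all _ fun ω => ?_)
  simp only [Set.indicator_apply, Set.mem_ofPred_eq]

lemma aHat_eq (z : ℕ × Ω) : (S z.1).aHat ψ z.2 =
    (PerturbedLS.gram' (rctRegressor S ψ Δ) (rctError S ψ Δ) z)⁻¹ *ᵥ obsMean S ψ z := by
  rw [CrossFitSample.aHat, CrossFitSample.gramHat, PerturbedLS.gram']
  simp only [rctRegressor, rctError, add_sub_cancel]
  rfl

/-- Scaling by `n` exposes a sandwich with an averaged middle matrix, plus `n/N` times a mean
square. The factor `* 1` presents the centering as a scalar times a constant array, the form in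
which mean-square bounds combine. -/
lemma size_mul_VHat_eq (z : ℕ × Ω) (b : Fin p → ℝ) :
    (n z.1 : ℝ) * (S z.1).VHat ψ b z.2 =
      (S z.1).aHat ψ z.2 ⬝ᵥ ((Matrix.of fun j k => (n z.1 : ℝ)⁻¹ *
        ∑ i, (S z.1).rHat ψ b z.2 i j * (S z.1).rHat ψ b z.2 i k) *ᵥ (S z.1).aHat ψ z.2) +
      (n z.1 : ℝ) / (N z.1 : ℝ) * ((N z.1 : ℝ)⁻¹ * ∑ i,
        (∑ j, b j * (obsRegressor S ψ Δ j z i + obsError S ψ Δ j z i) +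
          -(b ⬝ᵥ obsMean S ψ z) * 1) ^ 2) := by
  have hmat : (Matrix.of fun j k => (n z.1 : ℝ)⁻¹ *
      ∑ i, (S z.1).rHat ψ b z.2 i j * (S z.1).rHat ψ b z.2 i k) = (n z.1 : ℝ) •
      (((n z.1 : ℝ) ^ 2)⁻¹ • ∑ i, Matrix.vecMulVec ((S z.1).rHat ψ b z.2 i)
        ((S z.1).rHat ψ b z.2 i)) := by
    ext j k
    simp only [Matrix.of_apply, Matrix.smul_apply, Matrix.sum_apply, Matrix.vecMulVec_apply,
      smul_eq_mul]
    rw [← mul_assoc]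
    congr 1
    rcases eq_or_ne (n z.1 : ℝ) 0 with h | h
    · simp [h]
    · field_simp
  rw [CrossFitSample.VHat, hmat, mul_add,
    (S z.1).sum_foldSet z.2 fun k i =>
      (calibrate ψ b ((S z.1).contrastCF k z.2 ((S z.1).obs i z.2).1) - (S z.1).tauHat ψ b z.2) ^ 2,
    tauHat_eq]
  congr 1
  · simp only [Matrix.smul_mulVec, dotProduct_smul, smul_eq_mul]
  simp only [calibrate, obsRegressor, obsError, add_sub_cancel, mul_one]
  simp only [sub_eq_add_neg]
  rw [← mul_assoc, ← mul_assoc]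
  congr 1
  rw [sq, mul_inv, ← mul_assoc, div_eq_mul_inv]

/-- Consistency of the variance estimate. -/
lemma tendsto_size_mul_VHat [IsProbabilityMeasure P] [IsProbabilityMeasure Prct]
    [IsProbabilityMeasure Pobs]
    (hR : RegressorRate S ψ Δ) (hψ : Measurable ψ) (hΔ : Measurable Δ)
    (hn : Tendsto n atTop atTop) (hN : Tendsto N atTop atTop)
    (hnN : Tendsto (fun t => (n t : ℝ) / (N t : ℝ)) atTop (𝓝 0))
    (hψ_obs : ∀ j, MemLp (fun x => ψ (Δ x) j) 2 (Pobs.map Prod.fst))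
    {μbar : 𝓧 → ℝ} {β₀ : Fin p → ℝ} (hμ : ∀ x, μbar x = ∑ j, β₀ j * ψ (Δ x) j)
    (hscore : ∀ j, MemLp (fun w : ℝ × 𝓧 => (w.1 - μbar w.2) * ψ (Δ w.2) j) 2 Prct)
    {β : ℕ → Ω → Fin p → ℝ}
    (hLS : PerturbedLS (probFilter P) (fun z : ℕ × Ω => n z.1) (rctRegressor S ψ Δ)
      (rctError S ψ Δ) (rctResid S μbar) β₀ (fun z => β z.1 z.2)
      (gramMatrix (Prct.map Prod.snd) ψ Δ))
    (h4 : ∫⁻ x, ‖ψ (Δ x)‖ₑ ^ 4 ∂(Prct.map Prod.snd) < ∞) :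
    Tendsto (fun z : ℕ × Ω => (n z.1 : ℝ) * (S z.1).VHat ψ (β z.1 z.2) z.2) (probFilter P)
      (𝓝 (asympVar Prct Pobs ψ Δ μbar)) := by
  have hφm : ∀ j, Measurable fun w : ℝ × 𝓧 => ψ (Δ w.2) j := fun j =>
    (measurable_coord hψ j).comp (hΔ.comp measurable_snd)
  have hμm : Measurable μbar := by
    have : μbar = fun x => calibrate ψ β₀ (Δ x) := funext hμ
    rw [this]
    exact (measurable_calibrate hψ β₀).comp hΔ
  have hem : Measurable fun w : ℝ × 𝓧 => w.1 - μbar w.2 :=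
    measurable_fst.sub (hμm.comp measurable_snd)
  have hψΔ : Measurable fun w : ℝ × 𝓧 => ψ (Δ w.2) := hψ.comp (hΔ.comp measurable_snd)
  have hint4 : Integrable (fun w : ℝ × 𝓧 => ‖ψ (Δ w.2)‖ ^ 4) Prct := by
    refine ⟨(hψΔ.norm.pow_const 4).aestronglyMeasurable, ?_⟩
    have hm : Measurable fun x => ‖ψ (Δ x)‖ₑ ^ 4 := (hψ.comp hΔ).enorm.pow_const 4
    rw [lintegral_map hm measurable_snd] at h4
    simpa [HasFiniteIntegral, enorm_pow] using h4
  have hquart : ∀ j k, MeanSqBdd (probFilter P) fun z i =>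
      rctRegressor S ψ Δ j z i * rctRegressor S ψ Δ k z i := by
    intro j k
    have hm : Measurable fun w : ℝ × 𝓧 => (ψ (Δ w.2) j * ψ (Δ w.2) k) ^ 2 :=
      ((hφm j).mul (hφm k)).pow_const 2
    have hi : Integrable (fun w : ℝ × 𝓧 => (ψ (Δ w.2) j * ψ (Δ w.2) k) ^ 2) Prct := by
      refine hint4.mono' hm.aestronglyMeasurable (ae_of_all _ fun w => ?_)
      have h1 := PiLp.norm_apply_le (ψ (Δ w.2)) j
      have h2 := PiLp.norm_apply_le (ψ (Δ w.2)) k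
      rw [norm_pow, norm_mul]
      calc (‖ψ (Δ w.2) j‖ * ‖ψ (Δ w.2) k‖) ^ 2 ≤ (‖ψ (Δ w.2)‖ * ‖ψ (Δ w.2)‖) ^ 2 := by gcongr
        _ = _ := by ring
    have h := (iidRows_rct S).tendsto_mean hn
      (f := fun w => (ψ (Δ w.2) j * ψ (Δ w.2) k) ^ 2) hm hi
    exact MeanSqBdd.of_tendsto (a := fun z i => rctRegressor S ψ Δ j z i * rctRegressor S ψ Δ k z i)
      h
  have hmeat : ∀ j k, Tendsto (fun z : ℕ × Ω => (n z.1 : ℝ)⁻¹ * ∑ i,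
      (rctResid S μbar z i * rctRegressor S ψ Δ j z i) *
        (rctResid S μbar z i * rctRegressor S ψ Δ k z i)) (probFilter P)
      (𝓝 (meatMatrix Prct ψ Δ μbar j k)) := by
    intro j k
    have h := (iidRows_rct S).tendsto_mean hn (f := fun w =>
      ((w.1 - μbar w.2) * ψ (Δ w.2) j) * ((w.1 - μbar w.2) * ψ (Δ w.2) k))
      ((hem.mul (hφm j)).mul (hem.mul (hφm k)))
      (MemLp.integrable_mul (hscore j) (hscore k))
    have hM : meatMatrix Prct ψ Δ μbar j k = ∫ w, ((w.1 - μbar w.2) * ψ (Δ w.2) j) *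
        ((w.1 - μbar w.2) * ψ (Δ w.2) k) ∂Prct := by
      rw [meatMatrix, Matrix.of_apply]
      exact integral_congr_ae (ae_of_all _ fun w => by ring)
    rw [hM]
    exact h
  have hmeat' : Tendsto (fun z : ℕ × Ω => Matrix.of fun j k => (n z.1 : ℝ)⁻¹ * ∑ i,
      (S z.1).rHat ψ (β z.1 z.2) z.2 i j * (S z.1).rHat ψ (β z.1 z.2) z.2 i k) (probFilter P)
      (𝓝 (meatMatrix Prct ψ Δ μbar)) := by
    refine tendsto_pi_nhds.2 fun j => tendsto_pi_nhds.2 fun k => ?_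
    refine (hLS.tendsto_meat hmeat hquart j k).congr fun z => ?_
    simp only [Matrix.of_apply, CrossFitSample.rHat, calibrate, rctResid, rctRegressor, rctError,
      hμ, sub_add_cancel, add_sub_cancel]
  have hrate := hR.sqrt_mul_obsMean_sub hψ hΔ hψ_obs hn hN hnN
  have hbar := hLS.tendsto_of_sqrt_rate hrate
  have ha : Tendsto (fun z : ℕ × Ω => (S z.1).aHat ψ z.2) (probFilter P)
      (𝓝 (alphaBar (Prct.map Prod.snd) (Pobs.map Prod.fst) ψ Δ)) :=
    (hLS.tendsto_gram'_inv_mulVec hbar).congr fun z => (aHat_eq z).symm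
  have hβ := tendsto_pi_nhds.1 hLS.tendsto_coeff
  have htau : Tendsto (fun z : ℕ × Ω => β z.1 z.2 ⬝ᵥ obsMean S ψ z) (probFilter P)
      (𝓝 (β₀ ⬝ᵥ fun j => ∫ x, ψ (Δ x) j ∂(Pobs.map Prod.fst))) := by
    simp only [dotProduct]
    exact tendsto_finsetSum _ fun j _ => (hβ j).mul ((tendsto_pi_nhds.1 hbar) j)
  have hobsErr : ∀ j, MeanSqNull (probFilter P) (obsError S ψ Δ j) := by
    intro j
    refine .of_le ?_ (hR.tendsto_obsError hψ hΔ hn hN j)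
    -- Once `n ≥ 1`, the weight `1/N` is at most `n/N`, for which the sum of squared errors is
    -- already known to vanish.
    filter_upwards [(hn.comp tendsto_fst_probFilter).eventually_ge_atTop 1] with z hz
    have hz' : (1 : ℝ) ≤ n z.1 := Nat.one_le_cast.2 hz
    rw [inv_eq_one_div]
    gcongr
  have hobsReg : ∀ j, MeanSqBdd (probFilter P) (obsRegressor S ψ Δ j) := by
    intro j
    have hm : Measurable fun o : 𝓧 × Bool × ℝ => ψ (Δ o.1) j :=
      (measurable_coord hψ j).comp (hΔ.comp measurable_fst)
    have hL : MemLp (fun o : 𝓧 × Bool × ℝ => ψ (Δ o.1) j) 2 Pobs :=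
      (hψ_obs j).comp_of_map measurable_fst.aemeasurable
    have h := (iidRows_obs S).tendsto_mean hN (f := fun o => ψ (Δ o.1) j ^ 2)
      (hm.pow_const 2) hL.integrable_sq
    exact MeanSqBdd.of_tendsto (a := obsRegressor S ψ Δ j) h
  have hone : MeanSqBdd (probFilter P) fun (z : ℕ × Ω) (_ : Fin (N z.1)) => (1 : ℝ) := by
    refine ⟨1, Eventually.of_forall fun z => ?_⟩
    simpa using inv_mul_le_one
  obtain ⟨C, hC⟩ := (MeanSqBdd.sum Finset.univ fun j _ =>
    ((hobsReg j).add (hobsErr j).meanSqBdd).scalar_mul (hβ j)).add (hone.scalar_mul htau.neg)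
  have hsecond : Tendsto (fun z : ℕ × Ω => (n z.1 : ℝ) / (N z.1 : ℝ) * ((N z.1 : ℝ)⁻¹ * ∑ i,
        (∑ j, β z.1 z.2 j * (obsRegressor S ψ Δ j z i + obsError S ψ Δ j z i) +
          -(β z.1 z.2 ⬝ᵥ obsMean S ψ z) * 1) ^ 2)) (probFilter P) (𝓝 0) := by
    refine tendsto_of_tendsto_of_tendsto_of_le_of_le' tendsto_const_nhds
      (h := fun z => (n z.1 : ℝ) / (N z.1 : ℝ) * C)
      (by simpa using (hnN.comp (tendsto_fst_probFilter (P := P))).mul_const C)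
      (Eventually.of_forall fun z => by positivity) ?_
    filter_upwards [hC] with z hz
    gcongr
  have hfirst : Tendsto (fun z : ℕ × Ω => (S z.1).aHat ψ z.2 ⬝ᵥ ((Matrix.of fun j k =>
      (n z.1 : ℝ)⁻¹ * ∑ i, (S z.1).rHat ψ (β z.1 z.2) z.2 i j *
        (S z.1).rHat ψ (β z.1 z.2) z.2 i k) *ᵥ (S z.1).aHat ψ z.2)) (probFilter P)
      (𝓝 (asympVar Prct Pobs ψ Δ μbar)) := by
    have hv := tendsto_pi_nhds.1 (hmeat'.matrix_mulVec ha)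
    simp only [asympVar, dotProduct]
    exact tendsto_finsetSum _ fun j _ => ((tendsto_pi_nhds.1 ha) j).mul (hv j)
  have h := hfirst.add hsecond
  rw [add_zero] at h
  exact h.congr fun z => (size_mul_VHat_eq z _).symm

end Estimator

/-! ### The main theorem. -/

theorem theorem1
    {Ω 𝓧 𝓤 : Type*} [MeasurableSpace Ω] [MeasurableSpace 𝓧] [MeasurableSpace 𝓤]
    (P : Measure Ω) [IsProbabilityMeasure P]
    -- population distributions of `(D, X)` and of `(X, Z, Y)`
    (Prct : Measure (ℝ × 𝓧)) [IsProbabilityMeasure Prct]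
    (Pobs : Measure (𝓧 × Bool × ℝ)) [IsProbabilityMeasure Pobs]
    -- covariate densities with respect to a common measure, and dominance
    (lam : Measure 𝓧) (f_rct f_obs : 𝓧 → ℝ≥0∞)
    (hf_rct : Measurable f_rct) (hf_obs : Measurable f_obs)
    (hdens_rct : Prct.map Prod.snd = lam.withDensity f_rct)
    (hdens_obs : Pobs.map Prod.fst = lam.withDensity f_obs)
    (hdom : ∀ᵐ x ∂lam, f_obs x = 0 → f_rct x = 0)
    -- basis expansion, contrast, best calibration, and the moments in the definitions
    {p : ℕ} (ψ : ℝ → EuclideanSpace ℝ (Fin p)) (hψ : Measurable ψ)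
    (Δ : 𝓧 → ℝ) (hΔ : IsTreatmentContrast Pobs Δ)
    (hD : MemLp (fun w : ℝ × 𝓧 => w.1) 2 Prct)
    (hψ_rct : ∀ j, MemLp (fun x => ψ (Δ x) j) 2 (Prct.map Prod.snd))
    (hψ_obs : ∀ j, MemLp (fun x => ψ (Δ x) j) 2 (Pobs.map Prod.fst))
    (hgram : IsUnit (gramMatrix (Prct.map Prod.snd) ψ Δ))
    (μbar : 𝓧 → ℝ) (hμbar : IsBestCalibration Prct ψ Δ μbar)
    (hscore : ∀ j, MemLp (fun w : ℝ × 𝓧 => (w.1 - μbar w.2) * ψ (Δ w.2) j) 2 Prct)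
    -- sample sizes
    (n N : ℕ → ℕ) (hn : Tendsto n atTop atTop) (hN : Tendsto N atTop atTop)
    (hnN : Tendsto (fun t => (n t : ℝ) / (N t : ℝ)) atTop (𝓝 0))
    -- samples, cross-fit estimates and least squares coefficients
    (K : ℕ) (hK : 0 < K)
    (S : ∀ t, CrossFitSample 𝓤 P Prct Pobs (n t) (N t) K)
    (β : ℕ → Ω → Fin p → ℝ) (hβ_meas : ∀ t, AEMeasurable (β t) P)
    (hβ : ∀ t ω, (S t).IsOLS ψ ω (β t ω))
    -- rate condition
    (hrate : ∀ (j : Fin p) (k : Fin K), IsLittleOp P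
      (fun t ω =>
        eLpNorm (fun x => ψ ((S t).contrastAvg ω x) j - ψ (Δ x) j) 2 (Prct.map Prod.snd) +
        eLpNorm (fun x => ψ ((S t).contrastCF k ω x) j - ψ (Δ x) j) 2 (Pobs.map Prod.fst))
      (fun t => (√(n t : ℝ))⁻¹)) :
    -- asymptotic normality
    TendstoInDistribution
      (fun t ω => √(n t : ℝ) *
        ((S t).tauHat ψ (β t ω) ω - ∫ x, μbar x ∂(Pobs.map Prod.fst)))
      atTop (id : ℝ → ℝ) (fun _ => P)
      (gaussianReal 0 (asympVar Prct Pobs ψ Δ μbar).toNNReal) ∧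
    -- consistency of the variance estimate and coverage
    ∀ ε : ℝ, 0 < ε →
      (∀ j : Fin p, IsLittleOp P
        (fun t ω => eLpNorm (fun x => ψ ((S t).contrastAvg ω x) j - ψ (Δ x) j)
          (ENNReal.ofReal (2 + ε)) (Prct.map Prod.snd))
        (fun _ => 1)) →
      MemLp (fun w : ℝ × 𝓧 => w.1) 4 Prct →
      (∀ q : ℕ, ∫⁻ x, ‖ψ (Δ x)‖ₑ ^ q ∂(Prct.map Prod.snd) < ∞) →
      liminf (fun t => P {ω | ∀ q : ℕ,
        ∫⁻ x, ‖ψ ((S t).contrastAvg ω x)‖ₑ ^ q ∂(Prct.map Prod.snd) < ∞}) atTop = 1 →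
      TendstoInMeasure P (fun t ω => (n t : ℝ) * (S t).VHat ψ (β t ω) ω) atTop
        (fun _ => asympVar Prct Pobs ψ Δ μbar) ∧
      (0 < asympVar Prct Pobs ψ Δ μbar →
        ∀ α : ℝ, α ∈ Set.Ioo (0 : ℝ) 1 →
          ENNReal.ofReal (1 - α) ≤ liminf (fun t => P {ω |
            (S t).tauHat ψ (β t ω) ω -
                stdNormalQuantile (1 - α / 2) * √((S t).VHat ψ (β t ω) ω) ≤
              ∫ x, μbar x ∂(Pobs.map Prod.fst) ∧
            ∫ x, μbar x ∂(Pobs.map Prod.fst) ≤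
              (S t).tauHat ψ (β t ω) ω +
                stdNormalQuantile (1 - α / 2) * √((S t).VHat ψ (β t ω) ω)}) atTop) := by
  have hΔm := hΔ.measurable
  have hrate' : RegressorRate S ψ Δ := hrate
  obtain ⟨β₀, hμ, he, h0⟩ := hμbar.exists_coeff hD
    fun j => (hψ_rct j).comp_of_map measurable_snd.aemeasurable
  have hLS := perturbedLS_crossFit hrate' hψ hΔm hK hn hψ_rct hgram hμ he hscore h0 hβ
  have hobs := hrate'.sqrt_mul_obsMean_sub hψ hΔm hψ_obs hn hN hnN
  have hτ : ∫ x, μbar x ∂(Pobs.map Prod.fst) =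
      β₀ ⬝ᵥ fun j => ∫ x, ψ (Δ x) j ∂(Pobs.map Prod.fst) := by
    have : IsProbabilityMeasure (Pobs.map Prod.fst) :=
      Measure.isProbabilityMeasure_map measurable_fst.aemeasurable
    simp only [hμ, dotProduct]
    rw [integral_finsetSum _ fun j _ => ((hψ_obs j).integrable one_le_two).const_mul _]
    exact Finset.sum_congr rfl fun j _ => integral_const_mul _ _
  obtain ⟨hfL, hf0, hfvar⟩ := variance_linear_score hscore h0
    (rfl : _ = alphaBar (Prct.map Prod.snd) (Pobs.map Prod.fst) ψ Δ)
  set a := alphaBar (Prct.map Prod.snd) (Pobs.map Prod.fst) ψ Δ with ha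
  have hμm : Measurable μbar := by
    have : μbar = fun x => calibrate ψ β₀ (Δ x) := funext hμ
    rw [this]
    exact (measurable_calibrate hψ β₀).comp hΔm
  have hfm : Measurable fun w : ℝ × 𝓧 => ∑ j, (w.1 - μbar w.2) * ψ (Δ w.2) j * a j :=
    Finset.measurable_sum _ fun j _ => ((measurable_fst.sub (hμm.comp measurable_snd)).mul
      ((measurable_coord hψ j).comp (hΔm.comp measurable_snd))).mul_const _
  have hclt := (iidRows_rct S).tendstoInDistribution hn hfm hfL hf0
  rw [hfvar] at hclt
  have hnormal : TendstoInDistribution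
      (fun t ω => √(n t : ℝ) *
        ((S t).tauHat ψ (β t ω) ω - ∫ x, μbar x ∂(Pobs.map Prod.fst)))
      atTop (id : ℝ → ℝ) (fun _ => P)
      (gaussianReal 0 (asympVar Prct Pobs ψ Δ μbar).toNNReal) := by
    -- Slutsky's lemma: the scaled estimation error and the linearized score of `hclt` differ by a
    -- null sequence.
    refine tendstoInDistribution_of_tendstoInMeasure_sub _ _ hclt ?_ fun t =>
      ((aemeasurable_tauHat (S t) hψ (hβ_meas t)).sub_const _).const_mul _
    refine tendstoInMeasure_const_iff.2
      ((hLS.tendsto_sqrt_mul_sub_scaledScore hobs).congr fun z => ?_)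
    rw [Pi.sub_apply, Pi.sub_apply, hτ, tauHat_eq S z]
    congr 1
    change PerturbedLS.scaledScore _ _ z ⬝ᵥ a = _
    simp only [PerturbedLS.scaledScore, dotProduct, rctResid, rctRegressor, Finset.mul_sum,
      Finset.sum_mul]
    rw [Finset.sum_comm]
    exact Finset.sum_congr rfl fun i _ => Finset.sum_congr rfl fun j _ => by ring
  refine ⟨hnormal, fun ε _ _ _ hmom _ => ?_⟩
  have hV := tendsto_size_mul_VHat hrate' hψ hΔm hn hN hnN hψ_obs hμ hscore hLS (hmom 4)
  refine ⟨tendstoInMeasure_const_iff.2 hV, fun hpos α hα => ?_⟩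
  refine le_liminf_coverage hpos hnormal
    (W := fun t ω => (n t : ℝ) * (S t).VHat ψ (β t ω) ω) hV hα ?_
  filter_upwards [hn.eventually_gt_atTop 0] with t ht ω hω
  have hs : 0 < √(n t : ℝ) := Real.sqrt_pos.2 (Nat.cast_pos.2 ht)
  simp only [Set.mem_ofPred_eq] at hω ⊢
  -- The common factor `√n` cancels, so the studentized event is contained in the event that the
  -- interval covers.
  rw [Real.sqrt_mul (Nat.cast_nonneg _), abs_mul, abs_of_pos hs, mul_left_comm] at hω
  have h := abs_lt.1 (lt_of_mul_lt_mul_left hω hs.le)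
  constructor <;> linarith [h.1, h.2]
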